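/- Let $n=2j\in\{0,1,2,\dots\}$. On $\mathbb C^{n+1}$ with standard basis $|j,m\rangle$, $m=j,j-1,\dots,-j$, let $J_+|j,m\rangle=\sqrt{(j-m)(j+m+1)}\,|j,m+1\rangle$ and $J_-=J_+^T$. For integers $0\le l\le n$ and $-l\le m\le l$ put $E(l,l)=J_+^l$, $E(l,m-1)=[J_-,E(l,m)]$, and $\mathbf e^j(l,l)=\frac{(-1)^l}{\|J_+^l\|}J_+^l$, $\mathbf e^j(l,m-1)=\frac{1}{\sqrt{(l+m)(l-m+1)}}[J_-,\mathbf e^j(l,m)]$, with the norm of the Hilbert–Schmidt inner product $\langle P,Q\rangle=\operatorname{tr}(P^*Q)$. Put $\mathbf e^j(l,m)=E(l,m)=0$ for $|m|>l$. Let $\mathcal M[j]^{l_1,l_2,l}_{m_1,m_2,m}=\langle \mathbf e^j(l,m),\,\mathbf e^j(l_1,m_1)\mathbf e^j(l_2,m_2)\rangle$ be the product coefficients, and define the Wigner product symbol by $$\mathcal M[j]^{l_1,l_2,l_3}_{m_1,m_2,-m_3}=(-1)^{2j-m_3}\begin{bmatrix}l_1&l_2&l_3\\m_1&m_2&m_3\end{bmatrix}\![j].$$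 Let $C^{j_1,j_2,j}_{m_1,m_2,m}=\langle(j_1j_2)jm|j_1m_1j_2m_2\rangle$ be the Clebsch–Gordan coefficients with the phase convention $C^{j_1,j_2,j}_{j_1,j-j_1,j}>0$. The $3jm$ symbol is defined by $C^{j_1,j_2,j_3}_{m_1,m_2,-m_3}=(-1)^{j_1-j_2-m_3}\sqrt{2j_3+1}\begin{pmatrix}j_1&j_2&j_3\\m_1&m_2&m_3\end{pmatrix}$. The $6j$ symbol is defined by the re-coupling coefficients $$\langle (j_{12}j_3)jm\,|\,(j_1j_{23})jm\rangle=(-1)^{j_1+j_2+j_3+j}\sqrt{(2j_{12}+1)(2j_{23}+1)}\begin{Bmatrix}j_1&j_2&j_{12}\\j_3&j&j_{23}\end{Bmatrix},$$ where the coefficients of the two vectors with respect to $|j_1m_1j_2m_2j_3m_3\rangle$ are $C^{j_1,j_2,j_{12}}_{m_1,m_2,m_{12}}C^{j_{12},j_3,j}_{m_{12},m_3,m}$ and $C^{j_2,j_3,j_{23}}_{m_2,m_3,m_{23}}C^{j_1,j_{23},j}_{m_1,m_{23},m}$. Let $\delta(l_1,l_2,l_3)=1$ mean $|l_1-l_2|\le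 l_3\le l_1+l_2$. Then for all integers $0\le l,l_i\le n$, $|m|\le l$, $|m_i|\le l_i$ the following holds. 1. $\mathbf e^j(l_1,m_1)\mathbf e^j(l_2,m_2)=\sum_{l=0}^{2j}\mathcal M[j]^{l_1,l_2,l}_{m_1,m_2,m_1+m_2}\,\mathbf e^j(l,m_1+m_2)$. 2. $\mathcal M[j]^{l_1,l_2,l}_{m_1,m_2,m}=\sum_{\mu_1,\mu_2,\mu_3=-j}^{j}(-1)^{j+\mu_2}C^{j,j,l_1}_{\mu_1,\mu_2,m_1}C^{j,j,l_2}_{-\mu_2,\mu_3,m_2}C^{j,j,l}_{\mu_1,\mu_3,m}$. 3. $\begin{bmatrix}l_1&l_2&l_3\\m_1&m_2&m_3\end{bmatrix}\![j]=\sqrt{(2l_1+1)(2l_2+1)(2l_3+1)}\sum_{\mu_1,\mu_2,\mu_3=-j}^{j}(-1)^{3j-\mu_1-\mu_2-\mu_3}\begin{pmatrix}j&l_1&j\\\mu_1&m_1&-\mu_2\end{pmatrix}\begin{pmatrix}j&l_2&j\\\mu_2&m_2&-\mu_3\end{pmatrix}\begin{pmatrix}j&l_3&j\\\mu_3&m_3&-\mu_1\end{pmatrix}$.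 4. The re-coupling coefficient that defines $\begin{Bmatrix}l_1&l_2&l_3\\j&j&j\end{Bmatrix}$ does not depend on the magnetic number at which it is taken, and $$\begin{bmatrix}l_1&l_2&l_3\\m_1&m_2&m_3\end{bmatrix}\![j]=\sqrt{(2l_1+1)(2l_2+1)(2l_3+1)}\begin{pmatrix}l_1&l_2&l_3\\-m_1&-m_2&-m_3\end{pmatrix}\begin{Bmatrix}l_1&l_2&l_3\\j&j&j\end{Bmatrix}.$$ 5. With $m=m_1+m_2$, $$\mathbf e^j(l_1,m_1)\mathbf e^j(l_2,m_2)=\sum_{l=0}^{2j}(-1)^{2j+m}\sqrt{(2l_1+1)(2l_2+1)(2l+1)}\begin{pmatrix}l_1&l_2&l\\-m_1&-m_2&m\end{pmatrix}\begin{Bmatrix}l_1&l_2&l\\j&j&j\end{Bmatrix}\mathbf e^j(l,m).$$ 6. The Wigner product symbol is invariant under cyclic permutations of its columns, is multiplied by $(-1)^{l_1+l_2+l_3}$ when its first two columns are exchanged and also when $(m_1,m_2,m_3)$ is replaced by $(-m_1,-m_2,-m_3)$, and vanishes unless $m_1+m_2+m_3=0$ and $\delta(l_1,l_2,l_3)=1$.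 7. (Parity property.) With $m=m_1+m_2$, the commutator (respectively anticommutator) of $\mathbf e^j(l_1,m_1)$ and $\mathbf e^j(l_2,m_2)$ equals $\sum_l 2(-1)^{2j+m}\begin{bmatrix}l_1&l_2&l\\m_1&m_2&-m\end{bmatrix}\![j]\,\mathbf e^j(l,m)$, summed over $0\le l\le n$ with $\delta(l_1,l_2,l)=1$ and $l\equiv l_1+l_2+1$ (respectively $l\equiv l_1+l_2$) modulo $2$. Likewise there are numbers $K^{l_1,l_2,l}_{m_1,m_2}$, depending on $n$, such that the commutator (respectively anticommutator) of $E(l_1,m_1)$ and $E(l_2,m_2)$ equals $\sum_l K^{l_1,l_2,l}_{m_1,m_2}E(l,m)$, summed over the same $l$. -/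

import Mathlib

/-!
Conventions. A spin `j ∈ {0, 1/2, 1, …}` is given by the natural number `n = 2j`, and a magnetic
number `m ∈ {j, j-1, …, -j}` by the integer `2m`. The space of a spin-`j` system is `ℂ^(n+1)`; its
`k`-th standard basis vector (`k = 0, …, n`) is `|j m⟩` with `m = j - k`. Only for the operator
basis `e^j(l,m)`, where `l` and `m` are always integers, are `l` and `m` not doubled.
-/

namespace SpinJ

/-- Twice the magnetic number `j - k` of the `k`-th standard basis vector, `n = 2j`. -/
def mag (n : ℕ) (k : Fin (n + 1)) : ℤ := (n : ℤ) - 2 * (k : ℕ)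

/-- The raising operator `J₊`: the entry in row `k`, column `k + 1` (counted from `0`) is
`√((n - k)(k + 1))`, and all other entries vanish. -/
noncomputable def jPlus (n : ℕ) : Matrix (Fin (n + 1)) (Fin (n + 1)) ℂ :=
  Matrix.of fun p q =>
    if (q : ℕ) = (p : ℕ) + 1 then ((√(((n : ℝ) - (p : ℕ)) * ((p : ℕ) + 1)) : ℝ) : ℂ) else 0

/-- The lowering operator `J₋ = J₊ᵀ`. -/
noncomputable def jMinus (n : ℕ) : Matrix (Fin (n + 1)) (Fin (n + 1)) ℂ :=
  (jPlus n).transpose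

/-- The operator `J₃ = diag(j, j - 1, …, -j)`. -/
noncomputable def jThree (n : ℕ) : Matrix (Fin (n + 1)) (Fin (n + 1)) ℂ :=
  Matrix.diagonal fun k => (n : ℂ) / 2 - ((k : ℕ) : ℂ)

/-- The Hilbert-Schmidt inner product `⟨P, Q⟩ = trace (P* Q)`. -/
noncomputable def hs {a b : ℕ} (P Q : Matrix (Fin a) (Fin b) ℂ) : ℂ :=
  (P.conjTranspose * Q).trace

/-! ### The coupled basis of the operator algebra -/

/-- The norm `μ_l = ‖(J₊)^l‖ = √(trace ((J₋)^l (J₊)^l))`. -/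
noncomputable def opNorm (n l : ℕ) : ℝ :=
  √((jMinus n ^ l * jPlus n ^ l).trace.re)

/-- `opBasisAux n l k` is `e^j(l, l - k)`: the start is `e^j(l,l) = (-1)^l (J₊)^l / μ_l`, and
`e^j(l, m-1) = [J₋, e^j(l,m)] / β_{l,m}` with `β_{l,m} = √((l + m)(l - m + 1))`, `m = l - k`. -/
noncomputable def opBasisAux (n l : ℕ) : ℕ → Matrix (Fin (n + 1)) (Fin (n + 1)) ℂ
  | 0 => ((-1 : ℂ) ^ l / ((opNorm n l : ℝ) : ℂ)) • jPlus n ^ l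
  | k + 1 =>
      (1 / ((√((2 * (l : ℝ) - k) * (k + 1)) : ℝ) : ℂ)) •
        (jMinus n * opBasisAux n l k - opBasisAux n l k * jMinus n)

/-- The coupled standard basis operator `e^j(l,m)` for `-l ≤ m ≤ l`; zero for other `m`. -/
noncomputable def opBasis (n l : ℕ) (m : ℤ) : Matrix (Fin (n + 1)) (Fin (n + 1)) ℂ :=
  if |m| ≤ (l : ℤ) then opBasisAux n l ((l : ℤ) - m).toNat else 0

/-- `opUnnormAux n l k` is `E(l, l - k)`: `E(l,l) = (J₊)^l` and `E(l,m-1) = [J₋, E(l,m)]`. -/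
noncomputable def opUnnormAux (n l : ℕ) : ℕ → Matrix (Fin (n + 1)) (Fin (n + 1)) ℂ
  | 0 => jPlus n ^ l
  | k + 1 => jMinus n * opUnnormAux n l k - opUnnormAux n l k * jMinus n

/-- The unnormalized operator `E(l,m)` for `-l ≤ m ≤ l`; zero for other `m`. -/
noncomputable def opUnnorm (n l : ℕ) (m : ℤ) : Matrix (Fin (n + 1)) (Fin (n + 1)) ℂ :=
  if |m| ≤ (l : ℤ) then opUnnormAux n l ((l : ℤ) - m).toNat else 0

/-- The product coefficient: the component of `e^j(l₁,m₁) e^j(l₂,m₂)` along `e^j(l,m)`. -/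
noncomputable def prodCoeff (n l₁ l₂ l : ℕ) (m₁ m₂ m : ℤ) : ℂ :=
  hs (opBasis n l m) (opBasis n l₁ m₁ * opBasis n l₂ m₂)

/-- The Wigner product symbol `[l₁ l₂ l₃; m₁ m₂ m₃][j]`, determined by
`prodCoeff(m₁, m₂, -m₃) = (-1)^(2j - m₃) [l₁ l₂ l₃; m₁ m₂ m₃][j]`. -/
noncomputable def wignerProd (n l₁ l₂ l₃ : ℕ) (m₁ m₂ m₃ : ℤ) : ℂ :=
  (-1 : ℂ) ^ ((n : ℤ) - m₃) * prodCoeff n l₁ l₂ l₃ m₁ m₂ (-m₃)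

/-- The triangle condition `δ(l₁, l₂, l₃) = 1` for integral spins (not doubled). -/
abbrev Triangle (l₁ l₂ l₃ : ℕ) : Prop :=
  |(l₁ : ℤ) - (l₂ : ℤ)| ≤ (l₃ : ℤ) ∧ l₃ ≤ l₁ + l₂

/-! ### Clebsch-Gordan coefficients

The tensor product of the spins `a / 2` and `b / 2` is realized as the space of
`(a + 1) × (b + 1)` matrices, `|k⟩ ⊗ |k'⟩` being the matrix with a single entry `1`
in position `(k, k')`. -/

/-- The action `P ↦ A P + P Bᵀ` of `A ⊗ 1 + 1 ⊗ B`. -/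
noncomputable def tensorAct {a b : ℕ} (A : Matrix (Fin a) (Fin a) ℂ)
    (B : Matrix (Fin b) (Fin b) ℂ) (P : Matrix (Fin a) (Fin b) ℂ) : Matrix (Fin a) (Fin b) ℂ :=
  A * P + P * B.transpose

/-- The uncoupled standard basis vector `|j₁ m₁ j₂ m₂⟩`, with `a = 2j₁`, `b = 2j₂`, `x = 2m₁`,
`y = 2m₂` (zero if `m₁` or `m₂` is not an admissible magnetic number). -/
noncomputable def uncoupled (a b : ℕ) (x y : ℤ) : Matrix (Fin (a + 1)) (Fin (b + 1)) ℂ :=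
  Matrix.of fun p q => if mag a p = x ∧ mag b q = y then 1 else 0

/-- `v` is the vector `|(j₁j₂) j j⟩`, `a = 2j₁`, `b = 2j₂`, `c = 2j`: a unit vector of weight `j`
annihilated by `J₊`, with phase fixed by `⟨j₁ j₁ j₂ (j-j₁) | v⟩ > 0`. -/
def IsCoupledTop (a b c : ℕ) (v : Matrix (Fin (a + 1)) (Fin (b + 1)) ℂ) : Prop :=
  tensorAct (jThree a) (jThree b) v = ((c : ℂ) / 2) • v ∧
  tensorAct (jPlus a) (jPlus b) v = 0 ∧
  hs v v = 1 ∧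
  0 < (hs (uncoupled a b a ((c : ℤ) - a)) v).re ∧
  (hs (uncoupled a b a ((c : ℤ) - a)) v).im = 0

open Classical in
/-- The vector `|(j₁j₂) j j⟩` (zero if spin `j` does not occur in the tensor product). -/
noncomputable def coupledTop (a b c : ℕ) : Matrix (Fin (a + 1)) (Fin (b + 1)) ℂ :=
  if h : ∃ v, IsCoupledTop a b c v then h.choose else 0

/-- `coupledAux a b c k` is `|(j₁j₂) j (j-k)⟩`, obtained from `|(j₁j₂) j j⟩` by
`J₋ |(j₁j₂) j m⟩ = β_{j,m} |(j₁j₂) j (m-1)⟩`, `β_{j,m} = √((j + m)(j - m + 1))`. -/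
noncomputable def coupledAux (a b c : ℕ) : ℕ → Matrix (Fin (a + 1)) (Fin (b + 1)) ℂ
  | 0 => coupledTop a b c
  | k + 1 =>
      (1 / ((√(((c : ℝ) - k) * (k + 1)) : ℝ) : ℂ)) •
        tensorAct (jMinus a) (jMinus b) (coupledAux a b c k)

/-- The coupled standard basis vector `|(j₁j₂) j m⟩`, `a = 2j₁`, `b = 2j₂`, `c = 2j`, `z = 2m`
(zero if `m` is not an admissible magnetic number of spin `j`). -/
noncomputable def coupled (a b c : ℕ) (z : ℤ) : Matrix (Fin (a + 1)) (Fin (b + 1)) ℂ :=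
  if |z| ≤ (c : ℤ) ∧ 2 ∣ (c : ℤ) - z then coupledAux a b c (((c : ℤ) - z) / 2).toNat else 0

/-- The Clebsch-Gordan coefficient `C^{j₁ j₂ j}_{m₁ m₂ m} = ⟨(j₁j₂) j m | j₁ m₁ j₂ m₂⟩`, all
arguments doubled. -/
noncomputable def clebschGordan (a b c : ℕ) (x y z : ℤ) : ℂ :=
  hs (coupled a b c z) (uncoupled a b x y)

/-! ### Wigner `3jm` and `6j` symbols -/

/-- The Wigner `3jm` symbol `(j₁ j₂ j₃; m₁ m₂ m₃)`, all arguments doubled, determined by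
`C^{j₁ j₂ j₃}_{m₁ m₂ -m₃} = (-1)^(j₁ - j₂ - m₃) √(2j₃ + 1) (j₁ j₂ j₃; m₁ m₂ m₃)`.
Whenever the Clebsch-Gordan coefficient is nonzero, `j₁ - j₂ - m₃` is an integer. -/
noncomputable def threeJM (a b c : ℕ) (x y z : ℤ) : ℂ :=
  (-1 : ℂ) ^ (((a : ℤ) - b - z) / 2) / ((√((c : ℝ) + 1) : ℝ) : ℂ) * clebschGordan a b c x y (-z)

/-- The coefficient of `|j₁ m₁ j₂ m₂ j₃ m₃⟩` in the vector `|(j₁₂ j₃) j m⟩` obtained by coupling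
first `j₁, j₂` to `j₁₂` and then `j₁₂, j₃` to `j`. Doubled arguments: `a, b, d` for `j₁, j₂, j₃`,
`c` for `j₁₂`, `J` for `j`, `M` for `m`. -/
noncomputable def couple12 (a b d c J : ℕ) (M x y z : ℤ) : ℂ :=
  clebschGordan a b c x y (x + y) * clebschGordan c d J (x + y) z M

/-- The coefficient of `|j₁ m₁ j₂ m₂ j₃ m₃⟩` in the vector `|(j₁ j₂₃) j m⟩` obtained by coupling
first `j₂, j₃` to `j₂₃` and then `j₁, j₂₃` to `j`. Doubled arguments: `a, b, d` for `j₁, j₂, j₃`,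
`f` for `j₂₃`, `J` for `j`, `M` for `m`. -/
noncomputable def couple23 (a b d f J : ℕ) (M x y z : ℤ) : ℂ :=
  clebschGordan b d f y z (y + z) * clebschGordan a f J x (y + z) M

/-- The re-coupling coefficient `⟨(j₁₂ j₃) j m | (j₁ j₂₃) j m⟩` in the triple tensor product of
`j₁, j₂, j₃`. Doubled arguments in the order `j₁ j₂ j₁₂ j₃ j j₂₃ m`. -/
noncomputable def recoupling (a b c d J f : ℕ) (M : ℤ) : ℂ :=
  ∑ p : Fin (a + 1), ∑ q : Fin (b + 1), ∑ r : Fin (d + 1),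
    (starRingEnd ℂ) (couple12 a b d c J M (mag a p) (mag b q) (mag d r)) *
      couple23 a b d f J M (mag a p) (mag b q) (mag d r)

/-- The Wigner `6j` symbol `{j₁ j₂ j₁₂; j₃ j j₂₃}`, all arguments doubled, determined by
`⟨(j₁₂ j₃) j m | (j₁ j₂₃) j m⟩ =
  (-1)^(j₁+j₂+j₃+j) √((2j₁₂+1)(2j₂₃+1)) {j₁ j₂ j₁₂; j₃ j j₂₃}`
at `m = j`. Whenever the re-coupling coefficient is nonzero, `j₁+j₂+j₃+j` is an integer. -/
noncomputable def sixJ (a b c d J f : ℕ) : ℂ :=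
  (-1 : ℂ) ^ ((a + b + d + J) / 2) / ((√(((c : ℝ) + 1) * ((f : ℝ) + 1)) : ℝ) : ℂ) *
    recoupling a b c d J f (J : ℤ)

/-- The factor `√((2l₁+1)(2l₂+1)(2l₃+1))`. -/
noncomputable def rootDim (l₁ l₂ l₃ : ℕ) : ℂ :=
  ((√((2 * (l₁ : ℝ) + 1) * (2 * (l₂ : ℝ) + 1) * (2 * (l₃ : ℝ) + 1)) : ℝ) : ℂ)

end SpinJ

open SpinJ

namespace SpinJ

open Matrix

/-! Everything rests on one uniqueness principle. In a tensor product of two spins, a vector of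
weight `c / 2` killed by `J₊` is determined by its component along `|j₁ j₁ j₂ (j - j₁)⟩`
(`IsTop.eq_zero_of_corner`). Hence any family of matrices that transforms like the standard basis of
a spin is a scalar multiple of the coupled basis (`IsMultiplet.exists_smul`), and the scalar is
found from a norm and the sign of a single entry. Clebsch-Gordan coefficients are recognized in this
way three times.

First, `X ↦ X * (dual n)ᵀ` identifies the operators with the tensor product of two spins `j` and
turns commutators into the tensor action. It carries `e^j(l,m)` to the coupled vector, so the matrix
entries of `e^j(l,m)` are, up to sign, the coefficients `C^{j,j,l}`. Orthonormality and the count `∑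
(2l + 1) = (n + 1)²` give the product rule; writing out the matrix product gives the sum of three
Clebsch-Gordan coefficients.

Second, the `k`-th rows of the operators `e^j(l, ·)` form a spin-`j` multiplet in the product of the
spins `l` and `j` (`isMultiplet_rowVector`). This expresses `C^{l,j,j}` and `C^{j,l,j}` by the same
entries and yields the sum of three `3jm` symbols.

Third, by the Leibniz rule the product coefficients form a spin-`l` multiplet in the product of `l₁`
and `l₂`, so they equal a constant `R` times `C^{l₁,l₂,l}`. In the re-coupling coefficient, the
chain `(j₁ j₂₃)` is a matrix product `e^j(l₁, ·) e^j(l₂, ·)`; contracting it with the coupled vector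
of `l₁, l₂` gives `R` times `e^j(l₃, ·)`, and the remaining sum is the norm of a row, which is the
same for all rows. So `R` is the `6j` symbol up to known factors, and the magnetic number drops out
(`recoupling_eq`).

For the symmetries, the Wigner product symbol is `(-1)^n` times the trace of a product of three
basis operators. Cyclicity is that of the trace. Exchange comes from the antiautomorphism `X ↦ dual
* Xᵀ * dualᵀ`, which multiplies `e^j(l,m)` by `(-1)^l`, and sign reversal comes from combining it
with transposition. The parity property follows from the exchange sign. -/

/-- The ladder coefficient `√((n - k)(k + 1))` of spin `n / 2`. -/
noncomputable def ladderCoeff (n k : ℕ) : ℂ := ((√(((n : ℝ) - k) * ((k : ℝ) + 1)) : ℝ) : ℂ)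

theorem ladderCoeff_self (n : ℕ) : ladderCoeff n n = 0 := by simp [ladderCoeff]

theorem ladderCoeff_of_le {n k : ℕ} (h : n ≤ k) : ladderCoeff n k = 0 := by
  have h1 : ((n : ℝ) - k) * ((k : ℝ) + 1) ≤ 0 :=
    mul_nonpos_of_nonpos_of_nonneg (by simpa using h) (by positivity)
  simp [ladderCoeff, Real.sqrt_eq_zero_of_nonpos h1]

theorem ladderCoeff_eq_ofReal_pos {n k : ℕ} (h : k < n) :
    ∃ r : ℝ, 0 < r ∧ ladderCoeff n k = r := by
  refine ⟨_, Real.sqrt_pos.mpr (mul_pos ?_ ?_), rfl⟩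
  · have : (k : ℝ) < n := by exact_mod_cast h
    linarith
  · positivity

theorem ladderCoeff_ne_zero {n k : ℕ} (h : k < n) : ladderCoeff n k ≠ 0 := by
  obtain ⟨r, hr, e⟩ := ladderCoeff_eq_ofReal_pos h
  rw [e]
  exact_mod_cast hr.ne'

theorem star_ladderCoeff (n k : ℕ) : star (ladderCoeff n k) = ladderCoeff n k := by
  simp [ladderCoeff]

theorem ladderCoeff_mul_self {n k : ℕ} (h : k ≤ n) :
    ladderCoeff n k * ladderCoeff n k = ((n : ℂ) - k) * (k + 1) := by
  have h1 : (0 : ℝ) ≤ ((n : ℝ) - k) * ((k : ℝ) + 1) := by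
    have : (k : ℝ) ≤ n := by exact_mod_cast h
    exact mul_nonneg (by linarith) (by positivity)
  rw [ladderCoeff, ← Complex.ofReal_mul, Real.mul_self_sqrt h1]
  push_cast
  ring

/-! ### Matrix entries of the spin operators and their commutation relations -/

theorem jPlus_apply (n : ℕ) (p q : Fin (n + 1)) :
    jPlus n p q = if (q : ℕ) = p + 1 then ladderCoeff n p else 0 := by
  simp [jPlus, ladderCoeff]

theorem jMinus_apply (n : ℕ) (p q : Fin (n + 1)) :
    jMinus n p q = if (p : ℕ) = q + 1 then ladderCoeff n q else 0 := by
  simp [jMinus, jPlus_apply]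

/-- The family is indexed by `ℕ`, so that `p + 1` needs no bound: on the last row the coefficient is
zero and the value of `f` there is irrelevant. -/
theorem sum_jPlus_smul {V : Type*} [AddCommGroup V] [Module ℂ V] (n : ℕ) (p : Fin (n + 1))
    (f : ℕ → V) : ∑ r : Fin (n + 1), jPlus n p r • f r = ladderCoeff n p • f (p + 1) := by
  by_cases h : (p : ℕ) + 1 < n + 1
  · rw [Finset.sum_eq_single (⟨p + 1, h⟩ : Fin (n + 1))]
    · simp [jPlus_apply]
    · intro r _ hr
      have : (r : ℕ) ≠ p + 1 := fun h' => hr (Fin.ext h')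
      simp [jPlus_apply, this]
    · simp
  · have hp : (p : ℕ) = n := by omega
    rw [hp, ladderCoeff_self, zero_smul]
    refine Finset.sum_eq_zero fun r _ => ?_
    have : (r : ℕ) ≠ p + 1 := by omega
    simp [jPlus_apply, this]

theorem sum_jMinus_smul_zero {V : Type*} [AddCommGroup V] [Module ℂ V] (n : ℕ) (p : Fin (n + 1))
    (f : ℕ → V) (hp : (p : ℕ) = 0) : ∑ r : Fin (n + 1), jMinus n p r • f r = 0 := by
  refine Finset.sum_eq_zero fun r _ => ?_
  simp [jMinus_apply, hp]

theorem sum_jMinus_smul_succ {V : Type*} [AddCommGroup V] [Module ℂ V] (n : ℕ) (p : Fin (n + 1))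
    (f : ℕ → V) (k : ℕ) (hp : (p : ℕ) = k + 1) :
    ∑ r : Fin (n + 1), jMinus n p r • f r = ladderCoeff n k • f k := by
  rw [Finset.sum_eq_single (⟨k, by omega⟩ : Fin (n + 1))]
  · simp [jMinus_apply, hp]
  · intro r _ hr
    have : k ≠ r := fun h' => hr (Fin.ext h'.symm)
    simp [jMinus_apply, hp, this]
  · simp

/-- The three generators `J₊`, `J₋`, `J₃`. -/
noncomputable def gen (n : ℕ) : Fin 3 → Matrix (Fin (n + 1)) (Fin (n + 1)) ℂ :=
  ![jPlus n, jMinus n, jThree n]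

@[simp] theorem gen_zero (n : ℕ) : gen n 0 = jPlus n := rfl
@[simp] theorem gen_one (n : ℕ) : gen n 1 = jMinus n := rfl
@[simp] theorem gen_two (n : ℕ) : gen n 2 = jThree n := rfl

/-- The permutation of the generators induced by transposition. -/
def genSwap : Fin 3 → Fin 3 := ![1, 0, 2]

@[simp] theorem genSwap_one : genSwap 1 = 0 := rfl
@[simp] theorem genSwap_two : genSwap 2 = 2 := rfl

theorem jMinus_transpose (n : ℕ) : (jMinus n)ᵀ = jPlus n := by simp [jMinus]

theorem gen_transpose (n : ℕ) (s : Fin 3) : (gen n s)ᵀ = gen n (genSwap s) := by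
  fin_cases s
  · rfl
  · simp [jMinus_transpose]
  · simp [jThree]

theorem gen_swap_apply (n : ℕ) (s : Fin 3) (p q : Fin (n + 1)) :
    gen n (genSwap s) p q = gen n s q p := by
  rw [← gen_transpose, transpose_apply]

theorem star_gen_apply (n : ℕ) (s : Fin 3) (p q : Fin (n + 1)) :
    star (gen n s p q) = gen n s p q := by
  fin_cases s
  · by_cases h : (q : ℕ) = p + 1 <;>
      simp [jPlus_apply, h, -Complex.star_def, star_ladderCoeff]
  · by_cases h : (p : ℕ) = q + 1 <;>
      simp [jMinus_apply, h, -Complex.star_def, star_ladderCoeff]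
  · by_cases h : p = q <;> simp [jThree, h]

theorem gen_conjTranspose (n : ℕ) (s : Fin 3) : (gen n s)ᴴ = gen n (genSwap s) := by
  ext p q
  rw [conjTranspose_apply, star_gen_apply, gen_swap_apply]

theorem jPlus_mul_jMinus (n : ℕ) :
    jPlus n * jMinus n = diagonal fun k : Fin (n + 1) => ((n : ℂ) - (k : ℕ)) * ((k : ℕ) + 1) := by
  ext p q
  have h := sum_jPlus_smul n p fun r => if r = q + 1 then ladderCoeff n q else 0
  simp only [smul_eq_mul] at h
  rw [mul_apply]
  simp only [jMinus_apply, h, diagonal_apply, add_left_inj, Fin.val_inj]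
  split_ifs with hpq
  · subst hpq
    exact ladderCoeff_mul_self (by omega)
  · simp

theorem jMinus_mul_jPlus (n : ℕ) :
    jMinus n * jPlus n = diagonal fun k : Fin (n + 1) => ((n : ℂ) - (k : ℕ) + 1) * (k : ℕ) := by
  ext p q
  rw [mul_apply]
  simp only [jPlus_apply, diagonal_apply]
  rcases Nat.eq_zero_or_pos (p : ℕ) with hp | hp
  · have h := sum_jMinus_smul_zero n p
      (fun r => if (q : ℕ) = r + 1 then ladderCoeff n r else 0) hp
    simp only [smul_eq_mul] at h
    rw [h, hp]
    simp
  · obtain ⟨k, hk⟩ : ∃ k, (p : ℕ) = k + 1 := ⟨p - 1, by omega⟩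
    have h := sum_jMinus_smul_succ n p
      (fun r => if (q : ℕ) = r + 1 then ladderCoeff n r else 0) k hk
    simp only [smul_eq_mul] at h
    rw [h]
    by_cases hpq : p = q
    · subst hpq
      rw [if_pos hk, if_pos rfl, ladderCoeff_mul_self (by omega), hk]
      push_cast
      ring
    · have : (q : ℕ) ≠ k + 1 := fun h' => hpq (Fin.ext (by omega))
      simp [hpq, this]

theorem commutator_jPlus_jMinus (n : ℕ) :
    jPlus n * jMinus n - jMinus n * jPlus n = (2 : ℂ) • jThree n := by
  rw [jPlus_mul_jMinus, jMinus_mul_jPlus, jThree, diagonal_sub, ← diagonal_smul]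
  congr 1
  funext k
  simp only [Pi.smul_apply, smul_eq_mul]
  ring

theorem commutator_jThree_jPlus (n : ℕ) :
    jThree n * jPlus n - jPlus n * jThree n = jPlus n := by
  ext p q
  simp only [Matrix.sub_apply, jThree, diagonal_mul, mul_diagonal, jPlus_apply]
  split_ifs with h
  · rw [h]
    push_cast
    ring
  · simp

theorem commutator_jThree_jMinus (n : ℕ) :
    jThree n * jMinus n - jMinus n * jThree n = -jMinus n := by
  ext p q
  simp only [Matrix.sub_apply, Matrix.neg_apply, jThree, diagonal_mul, mul_diagonal, jMinus_apply]
  split_ifs with h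
  · rw [h]
    push_cast
    ring
  · simp

/-! ### The Hilbert-Schmidt form and the action on tensor products -/

section Tensor

variable {a b : ℕ}

theorem hs_eq_sum (P Q : Matrix (Fin a) (Fin b) ℂ) :
    hs P Q = ∑ i, ∑ k, star (P i k) * Q i k := by
  simp only [hs, trace, diag_apply, mul_apply, conjTranspose_apply]
  exact Finset.sum_comm

theorem hs_add_right (P Q R : Matrix (Fin a) (Fin b) ℂ) : hs P (Q + R) = hs P Q + hs P R := by
  simp [hs, Matrix.mul_add]

theorem hs_sub_right (P Q R : Matrix (Fin a) (Fin b) ℂ) : hs P (Q - R) = hs P Q - hs P R := by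
  simp [hs, Matrix.mul_sub]

theorem hs_smul_right (r : ℂ) (P Q : Matrix (Fin a) (Fin b) ℂ) :
    hs P (r • Q) = r * hs P Q := by
  simp [hs]

theorem hs_smul_left (r : ℂ) (P Q : Matrix (Fin a) (Fin b) ℂ) :
    hs (r • P) Q = star r * hs P Q := by
  simp [hs]

theorem hs_zero_right (P : Matrix (Fin a) (Fin b) ℂ) : hs P 0 = 0 := by simp [hs]

theorem hs_zero_left (P : Matrix (Fin a) (Fin b) ℂ) : hs 0 P = 0 := by simp [hs]

theorem hs_sum_right {ι : Type*} (s : Finset ι) (P : Matrix (Fin a) (Fin b) ℂ)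
    (Q : ι → Matrix (Fin a) (Fin b) ℂ) : hs P (∑ i ∈ s, Q i) = ∑ i ∈ s, hs P (Q i) := by
  simp [hs, Matrix.mul_sum, trace_sum]

theorem hs_sum_left {ι : Type*} (s : Finset ι) (P : Matrix (Fin a) (Fin b) ℂ)
    (Q : ι → Matrix (Fin a) (Fin b) ℂ) : hs (∑ i ∈ s, Q i) P = ∑ i ∈ s, hs (Q i) P := by
  simp [hs, conjTranspose_sum, Matrix.sum_mul, trace_sum]

theorem star_hs (P Q : Matrix (Fin a) (Fin b) ℂ) : star (hs P Q) = hs Q P := by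
  rw [hs, hs, ← trace_conjTranspose, conjTranspose_mul, conjTranspose_conjTranspose]

theorem hs_self_eq_ofReal (P : Matrix (Fin a) (Fin b) ℂ) :
    ∃ r : ℝ, 0 ≤ r ∧ hs P P = r ∧ (r = 0 → P = 0) := by
  refine ⟨∑ i, ∑ k, ‖P i k‖ ^ 2, by positivity, ?_, ?_⟩
  · rw [hs_eq_sum]
    push_cast
    refine Finset.sum_congr rfl fun i _ => Finset.sum_congr rfl fun k _ => ?_
    rw [Complex.star_def, Complex.conj_mul']
  · intro h
    ext i k
    rw [Finset.sum_eq_zero_iff_of_nonneg fun i _ => by positivity] at h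
    have h1 := h i (Finset.mem_univ _)
    rw [Finset.sum_eq_zero_iff_of_nonneg fun i _ => by positivity] at h1
    simpa using h1 k (Finset.mem_univ _)

theorem eq_zero_of_hs_self {P : Matrix (Fin a) (Fin b) ℂ} (h : hs P P = 0) : P = 0 := by
  obtain ⟨r, -, h1, h2⟩ := hs_self_eq_ofReal P
  rw [h1] at h
  exact h2 (by exact_mod_cast h)

variable (A A' : Matrix (Fin a) (Fin a) ℂ) (B B' : Matrix (Fin b) (Fin b) ℂ)

theorem tensorAct_smul (r : ℂ) (P : Matrix (Fin a) (Fin b) ℂ) :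
    tensorAct A B (r • P) = r • tensorAct A B P := by
  simp [tensorAct]

theorem tensorAct_zero : tensorAct A B 0 = 0 := by simp [tensorAct]

theorem tensorAct_sub (P Q : Matrix (Fin a) (Fin b) ℂ) :
    tensorAct A B (P - Q) = tensorAct A B P - tensorAct A B Q := by
  simp only [tensorAct, Matrix.mul_sub, Matrix.sub_mul]
  abel

/-- The mixed terms, with one factor on each side of `P`, cancel; hence the tensor action is a Lie
algebra representation. -/
theorem tensorAct_commutator (P : Matrix (Fin a) (Fin b) ℂ) :
    tensorAct A B (tensorAct A' B' P) - tensorAct A' B' (tensorAct A B P) =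
      tensorAct (A * A' - A' * A) (B * B' - B' * B) P := by
  simp only [tensorAct, transpose_sub, transpose_mul, Matrix.mul_add, Matrix.add_mul,
    Matrix.mul_sub, Matrix.sub_mul, Matrix.mul_assoc]
  abel

theorem tensorAct_smul_left (r : ℂ) (P : Matrix (Fin a) (Fin b) ℂ) :
    tensorAct (r • A) (r • B) P = r • tensorAct A B P := by
  simp [tensorAct]

theorem tensorAct_neg_left (P : Matrix (Fin a) (Fin b) ℂ) :
    tensorAct (-A) (-B) P = -tensorAct A B P := by
  simp only [tensorAct, transpose_neg, Matrix.neg_mul, Matrix.mul_neg]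
  abel

theorem tensorAct_apply (P : Matrix (Fin a) (Fin b) ℂ) (p : Fin a) (q : Fin b) :
    tensorAct A B P p q = ∑ p', A p p' * P p' q + ∑ q', B q q' * P p q' := by
  simp only [tensorAct, Matrix.add_apply, mul_apply, transpose_apply]
  congr 1
  exact Finset.sum_congr rfl fun _ _ => mul_comm _ _

theorem hs_tensorAct_left (P Q : Matrix (Fin a) (Fin b) ℂ) :
    hs (tensorAct A B P) Q = hs P (tensorAct Aᴴ Bᴴ Q) := by
  simp only [hs, tensorAct, conjTranspose_add, conjTranspose_mul, Matrix.add_mul, Matrix.mul_add,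
    trace_add]
  congr 1
  · rw [Matrix.mul_assoc]
  · rw [Matrix.mul_assoc, trace_mul_comm, Matrix.mul_assoc]
    rfl

end Tensor

/-! ### The generators acting on the product of two spins -/

/-- The action of a generator on the tensor product of the spins `a / 2` and `b / 2`. -/
noncomputable abbrev act (a b : ℕ) (s : Fin 3) (P : Matrix (Fin (a + 1)) (Fin (b + 1)) ℂ) :
    Matrix (Fin (a + 1)) (Fin (b + 1)) ℂ :=
  tensorAct (gen a s) (gen b s) P

section Act

variable {a b : ℕ} (P Q : Matrix (Fin (a + 1)) (Fin (b + 1)) ℂ)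

theorem act_smul (s : Fin 3) (r : ℂ) : act a b s (r • P) = r • act a b s P :=
  tensorAct_smul _ _ r P

theorem act_apply (s : Fin 3) (p : Fin (a + 1)) (q : Fin (b + 1)) :
    act a b s P p q = ∑ p', gen a s p p' * P p' q + ∑ q', gen b s q q' * P p q' :=
  tensorAct_apply _ _ P p q

theorem act_sub (s : Fin 3) : act a b s (P - Q) = act a b s P - act a b s Q :=
  tensorAct_sub _ _ P Q

theorem act_zero (s : Fin 3) : act a b s 0 = 0 := tensorAct_zero _ _

theorem hs_act_left (s : Fin 3) : hs (act a b s P) Q = hs P (act a b (genSwap s) Q) := by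
  rw [hs_tensorAct_left, gen_conjTranspose, gen_conjTranspose]

theorem act_plus_minus :
    act a b 0 (act a b 1 P) = act a b 1 (act a b 0 P) + (2 : ℂ) • act a b 2 P := by
  rw [← sub_eq_iff_eq_add', tensorAct_commutator]
  simp only [gen_zero, gen_one, commutator_jPlus_jMinus, tensorAct_smul_left]
  rfl

theorem act_three_minus :
    act a b 2 (act a b 1 P) = act a b 1 (act a b 2 P) - act a b 1 P := by
  rw [sub_eq_add_neg, ← sub_eq_iff_eq_add', tensorAct_commutator]
  simp only [gen_one, gen_two, commutator_jThree_jMinus, tensorAct_neg_left]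
  rfl

end Act

/-! ### Highest-weight vectors and the multiplets they generate -/

section Ladder

variable {a b : ℕ}

/-- `v` has weight `c / 2` and is annihilated by `J₊`. -/
def IsTop (a b c : ℕ) (v : Matrix (Fin (a + 1)) (Fin (b + 1)) ℂ) : Prop :=
  act a b 2 v = ((c : ℂ) / 2) • v ∧ act a b 0 v = 0

/-- The normalized descending sequence starting at `v`. -/
noncomputable def ladder (a b c : ℕ) (v : Matrix (Fin (a + 1)) (Fin (b + 1)) ℂ) :
    ℕ → Matrix (Fin (a + 1)) (Fin (b + 1)) ℂ
  | 0 => v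
  | k + 1 => (1 / ladderCoeff c k) • act a b 1 (ladder a b c v k)

theorem ladder_succ (c : ℕ) (v : Matrix (Fin (a + 1)) (Fin (b + 1)) ℂ) (k : ℕ) :
    ladder a b c v (k + 1) = (1 / ladderCoeff c k) • act a b 1 (ladder a b c v k) := rfl

theorem coupledAux_eq_ladder (a b c k : ℕ) :
    coupledAux a b c k = ladder a b c (coupledTop a b c) k := by
  induction k with
  | zero => rfl
  | succ k ih => rw [coupledAux, ih]; rfl

theorem ladder_smul (c : ℕ) (r : ℂ) (v : Matrix (Fin (a + 1)) (Fin (b + 1)) ℂ) (k : ℕ) :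
    ladder a b c (r • v) k = r • ladder a b c v k := by
  induction k with
  | zero => rfl
  | succ k ih => rw [ladder, ladder, ih, act_smul, smul_comm]

variable {c : ℕ} {v : Matrix (Fin (a + 1)) (Fin (b + 1)) ℂ}

/-- The ladder stops because the coefficient vanishes and `1 / 0 = 0`. That `J₋` really kills the
last vector is a separate fact, contained in `IsTop.act_minus_ladder`. -/
theorem ladder_succ_of_le {k : ℕ} (h : c ≤ k) : ladder a b c v (k + 1) = 0 := by
  rw [ladder, ladderCoeff_of_le h]
  simp

theorem IsTop.smul (hv : IsTop a b c v) (r : ℂ) : IsTop a b c (r • v) := by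
  refine ⟨?_, ?_⟩
  · rw [act_smul, hv.1, smul_comm]
  · rw [act_smul, hv.2, smul_zero]

theorem IsTop.sub (hv : IsTop a b c v) {w : Matrix (Fin (a + 1)) (Fin (b + 1)) ℂ}
    (hw : IsTop a b c w) : IsTop a b c (v - w) := by
  refine ⟨?_, ?_⟩
  · rw [act_sub, hv.1, hw.1, smul_sub]
  · rw [act_sub, hv.2, hw.2, sub_zero]

theorem isTop_zero (a b c : ℕ) : IsTop a b c 0 := by
  refine ⟨?_, ?_⟩ <;> simp [act_zero]

theorem IsTop.act_three_ladder (hv : IsTop a b c v) (k : ℕ) :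
    act a b 2 (ladder a b c v k) = ((c : ℂ) / 2 - k) • ladder a b c v k := by
  induction k with
  | zero => simpa [ladder] using hv.1
  | succ k ih =>
    rw [ladder, act_smul, act_three_minus, ih, act_smul, smul_comm]
    push_cast
    module

theorem act_minus_ladder_of_lt {k : ℕ} (h : k < c) :
    act a b 1 (ladder a b c v k) = ladderCoeff c k • ladder a b c v (k + 1) := by
  rw [ladder, smul_smul, mul_one_div_cancel (ladderCoeff_ne_zero h), one_smul]

theorem IsTop.act_plus_ladder_succ (hv : IsTop a b c v) (k : ℕ) :
    act a b 0 (ladder a b c v (k + 1)) = ladderCoeff c k • ladder a b c v k := by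
  induction k with
  | zero =>
    rcases Nat.eq_zero_or_pos c with hc | hc
    · rw [ladder_succ_of_le hc.le, act_zero, ladderCoeff_of_le hc.le, zero_smul]
    · have h0 := ladderCoeff_ne_zero hc
      have h1 := ladderCoeff_mul_self hc.le
      rw [ladder_succ, act_smul, act_plus_minus, hv.act_three_ladder,
        show act a b 0 (ladder a b c v 0) = 0 from hv.2, act_zero, zero_add, smul_smul, smul_smul]
      congr 1
      field_simp
      push_cast at h1
      linear_combination -h1
  | succ k ih =>
    rcases Nat.lt_or_ge (k + 1) c with hc | hc
    · have h0 := ladderCoeff_ne_zero hc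
      have h1 := ladderCoeff_mul_self hc.le
      have h2 := ladderCoeff_mul_self (show k ≤ c by omega)
      rw [ladder, act_smul, act_plus_minus, hv.act_three_ladder, ih, act_smul,
        act_minus_ladder_of_lt (show k < c by omega), smul_smul, smul_smul, ← add_smul, smul_smul]
      congr 1
      field_simp
      push_cast at h1 ⊢
      -- The recursion of squared coefficients: `(c-k-1)(k+2) = (c-k)(k+1) + 2(c/2 - (k+1))`.
      linear_combination h2 - h1
    · rw [ladder_succ_of_le hc, act_zero, ladderCoeff_of_le hc, zero_smul]

theorem IsTop.act_minus_ladder (hv : IsTop a b c v) {k : ℕ} (h : k ≤ c) :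
    act a b 1 (ladder a b c v k) = ladderCoeff c k • ladder a b c v (k + 1) := by
  rcases h.lt_or_eq with h | rfl
  · exact act_minus_ladder_of_lt h
  · rw [ladderCoeff_self, zero_smul]
    -- At the bottom, the squared norm of `J₋ v_c` is `⟨v_c, (J₋ J₊ + 2 J₃) v_c⟩`, and on `v_c` the
    -- two terms contribute `c` and `2(c/2 - c)`, which cancel.
    refine eq_zero_of_hs_self ?_
    rw [hs_act_left, genSwap_one, act_plus_minus, hv.act_three_ladder]
    suffices h : act a b 1 (act a b 0 (ladder a b k v k)) = (k : ℂ) • ladder a b k v k by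
      rw [h, smul_smul, ← add_smul]
      rw [show (k : ℂ) + 2 * ((k : ℂ) / 2 - k) = 0 by ring, zero_smul, hs_zero_right]
    rcases k with _ | k
    · simp only [ladder, Nat.cast_zero, zero_smul]
      rw [hv.2, act_zero]
    · rw [hv.act_plus_ladder_succ, act_smul, act_minus_ladder_of_lt k.lt_succ_self,
        smul_smul, ladderCoeff_mul_self k.le_succ]
      push_cast
      congr 1
      ring

/-- The sequence `w` transforms under the generators like the standard basis of the spin
`c / 2`. -/
def IsMultiplet (a b c : ℕ) (w : ℕ → Matrix (Fin (a + 1)) (Fin (b + 1)) ℂ) : Prop :=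
  ∀ (s : Fin 3) (k : Fin (c + 1)), act a b s (w k) = ∑ i : Fin (c + 1), gen c s i k • w i

theorem sum_jThree_smul {V : Type*} [AddCommGroup V] [Module ℂ V] (n : ℕ) (p : Fin (n + 1))
    (f : ℕ → V) : ∑ r : Fin (n + 1), jThree n p r • f r = ((n : ℂ) / 2 - (p : ℕ)) • f p := by
  rw [Finset.sum_eq_single p]
  · simp [jThree]
  · intro r _ hr
    simp [jThree, hr.symm]
  · simp

theorem sum_gen_zero_smul_zero {V : Type*} [AddCommGroup V] [Module ℂ V] (n : ℕ)
    (p : Fin (n + 1)) (f : ℕ → V) (hp : (p : ℕ) = 0) :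
    ∑ r : Fin (n + 1), gen n 0 r p • f r = 0 := by
  rw [← sum_jMinus_smul_zero n p f hp]
  rfl

theorem sum_gen_zero_smul_succ {V : Type*} [AddCommGroup V] [Module ℂ V] (n : ℕ)
    (p : Fin (n + 1)) (f : ℕ → V) (k : ℕ) (hp : (p : ℕ) = k + 1) :
    ∑ r : Fin (n + 1), gen n 0 r p • f r = ladderCoeff n k • f k := by
  rw [← sum_jMinus_smul_succ n p f k hp]
  rfl

theorem sum_gen_one_smul {V : Type*} [AddCommGroup V] [Module ℂ V] (n : ℕ)
    (p : Fin (n + 1)) (f : ℕ → V) :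
    ∑ r : Fin (n + 1), gen n 1 r p • f r = ladderCoeff n p • f (p + 1) :=
  sum_jPlus_smul n p f

theorem sum_gen_two_smul {V : Type*} [AddCommGroup V] [Module ℂ V] (n : ℕ) (p : Fin (n + 1))
    (f : ℕ → V) : ∑ r : Fin (n + 1), gen n 2 r p • f r = ((n : ℂ) / 2 - (p : ℕ)) • f p := by
  rw [← sum_jThree_smul]
  refine Finset.sum_congr rfl fun r _ => ?_
  rw [← gen_swap_apply]
  rfl

theorem IsTop.isMultiplet_ladder (hv : IsTop a b c v) : IsMultiplet a b c (ladder a b c v) := by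
  intro s k
  fin_cases s
  · rcases hk : (k : ℕ) with _ | i
    · exact hv.2.trans (sum_gen_zero_smul_zero c k _ hk).symm
    · exact (hv.act_plus_ladder_succ i).trans (sum_gen_zero_smul_succ c k _ i hk).symm
  · exact (hv.act_minus_ladder (by omega)).trans (sum_gen_one_smul c k _).symm
  · exact (hv.act_three_ladder k).trans (sum_gen_two_smul c k _).symm

variable {w : ℕ → Matrix (Fin (a + 1)) (Fin (b + 1)) ℂ}

theorem IsMultiplet.isTop (hw : IsMultiplet a b c w) : IsTop a b c (w 0) := by
  refine ⟨?_, ?_⟩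
  · have h := hw 2 0
    rw [sum_gen_two_smul] at h
    simpa using h
  · exact (hw 0 0).trans (sum_gen_zero_smul_zero c 0 w rfl)

/-- The `J₋` relation recovers each vector from the preceding one, because the coefficients below
`c` are nonzero. -/
theorem IsMultiplet.eq_ladder (hw : IsMultiplet a b c w) {k : ℕ} (hk : k ≤ c) :
    w k = ladder a b c (w 0) k := by
  induction k with
  | zero => rfl
  | succ k ih =>
    have h := hw 1 ⟨k, by omega⟩
    rw [sum_gen_one_smul] at h
    rw [ladder, ← ih (by omega), h, smul_smul,
      one_div_mul_cancel (ladderCoeff_ne_zero (show k < c by omega)), one_smul]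

/-! ### Orthogonality -/

/-- Raising and lowering are adjoint and have the same coefficients on neighbouring vectors, so the
norm is constant along the ladder. -/
theorem IsTop.hs_ladder_self (hv : IsTop a b c v) {k : ℕ} (hk : k ≤ c) :
    hs (ladder a b c v k) (ladder a b c v k) = hs v v := by
  induction k with
  | zero => rfl
  | succ k ih =>
    rw [← ih (by omega)]
    have h0 := ladderCoeff_ne_zero (show k < c by omega)
    have h := hs_act_left (ladder a b c v k) (ladder a b c v (k + 1)) 1
    rw [genSwap_one, hv.act_plus_ladder_succ, act_minus_ladder_of_lt (by omega), hs_smul_left,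
      hs_smul_right, star_ladderCoeff] at h
    exact mul_left_cancel₀ h0 h

variable {c' : ℕ} {v' : Matrix (Fin (a + 1)) (Fin (b + 1)) ℂ}

/-- Lowering steps on the left become raising steps on the right, and more than `k'` of them pass
beyond the top. Only the right-hand vector has to be a top vector. -/
theorem IsTop.hs_ladder_of_lt (hv' : IsTop a b c' v') {k k' : ℕ}
    (hk : k ≤ c) (hlt : k' < k) : hs (ladder a b c v k) (ladder a b c' v' k') = 0 := by
  induction k' generalizing k with
  | zero =>
    obtain ⟨i, rfl⟩ : ∃ i, k = i + 1 := ⟨k - 1, by omega⟩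
    have h : act a b 0 (ladder a b c' v' 0) = 0 := hv'.2
    rw [ladder_succ, hs_smul_left, hs_act_left, genSwap_one, h, hs_zero_right, mul_zero]
  | succ k' ih =>
    obtain ⟨i, rfl⟩ : ∃ i, k = i + 1 := ⟨k - 1, by omega⟩
    rw [ladder_succ, hs_smul_left, hs_act_left, genSwap_one, hv'.act_plus_ladder_succ, hs_smul_right,
      ih (by omega) (by omega), mul_zero, mul_zero]

theorem hs_eq_zero_of_weight_ne {P Q : Matrix (Fin (a + 1)) (Fin (b + 1)) ℂ} {x y : ℂ}
    (hP : act a b 2 P = x • P) (hQ : act a b 2 Q = y • Q) (hne : star x ≠ y) : hs P Q = 0 := by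
  have h := hs_act_left P Q 2
  rw [genSwap_two, hP, hQ, hs_smul_left, hs_smul_right] at h
  by_contra h0
  exact hne (mul_right_cancel₀ h0 h)

theorem IsTop.hs_ladder_of_ne (hv : IsTop a b c v) (hv' : IsTop a b c' v') {k k' : ℕ}
    (hk : k ≤ c) (hk' : k' ≤ c') (hne : c ≠ c' ∨ k ≠ k') :
    hs (ladder a b c v k) (ladder a b c' v' k') = 0 := by
  rcases lt_trichotomy k' k with h | h | h
  · exact hv'.hs_ladder_of_lt hk h
  · subst h
    refine hs_eq_zero_of_weight_ne (hv.act_three_ladder _) (hv'.act_three_ladder _) ?_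
    simp only [star_sub, star_div₀, star_natCast, star_ofNat]
    intro h
    have : (c : ℂ) = c' := by linear_combination 2 * h
    exact (hne.resolve_right (by simp)) (by exact_mod_cast this)
  · rw [← star_hs, hv.hs_ladder_of_lt hk' h, star_zero]

end Ladder

/-! ### Uniqueness of coupled vectors -/

section Coupled

variable {a b : ℕ}

theorem mag_inj {n : ℕ} {p q : Fin (n + 1)} : mag n p = mag n q ↔ p = q := by
  rw [Fin.ext_iff, mag, mag]
  omega

theorem hs_uncoupled (p : Fin (a + 1)) (q : Fin (b + 1))
    (v : Matrix (Fin (a + 1)) (Fin (b + 1)) ℂ) :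
    hs (uncoupled a b (mag a p) (mag b q)) v = v p q := by
  rw [hs_eq_sum, Finset.sum_eq_single p, Finset.sum_eq_single q]
  · simp [uncoupled]
  · intro i _ hi
    simp [uncoupled, mag_inj, hi]
  · simp
  · intro i _ hi
    simp [uncoupled, mag_inj, hi]
  · simp

theorem act_three_apply (v : Matrix (Fin (a + 1)) (Fin (b + 1)) ℂ) (p : Fin (a + 1))
    (q : Fin (b + 1)) : act a b 2 v p q = ((mag a p + mag b q : ℤ) : ℂ) / 2 * v p q := by
  rw [act_apply, Finset.sum_eq_single p, Finset.sum_eq_single q]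
  · simp only [gen_two, jThree, diagonal_apply_eq, mag]
    push_cast
    ring
  · intro i _ hi
    simp [jThree, hi.symm]
  · simp
  · intro i _ hi
    simp [jThree, hi.symm]
  · simp

theorem apply_eq_zero_of_weight {v : Matrix (Fin (a + 1)) (Fin (b + 1)) ℂ} {x : ℤ}
    (hv : act a b 2 v = ((x : ℂ) / 2) • v) {p : Fin (a + 1)} {q : Fin (b + 1)}
    (h : mag a p + mag b q ≠ x) : v p q = 0 := by
  have h1 := act_three_apply v p q
  rw [hv, Matrix.smul_apply, smul_eq_mul] at h1
  by_contra h0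
  have h2 := mul_right_cancel₀ h0 h1
  apply h
  have h3 : ((mag a p + mag b q : ℤ) : ℂ) = x := by linear_combination -2 * h2
  exact_mod_cast h3

/-- The component of `v` along `|j₁ j₁ j₂ (j - j₁)⟩`. -/
noncomputable def corner (a b c : ℕ) (v : Matrix (Fin (a + 1)) (Fin (b + 1)) ℂ) : ℂ :=
  hs (uncoupled a b a ((c : ℤ) - a)) v

theorem corner_eq (c : ℕ) (v : Matrix (Fin (a + 1)) (Fin (b + 1)) ℂ) (q : Fin (b + 1))
    (h : mag b q = (c : ℤ) - a) : corner a b c v = v 0 q := by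
  rw [corner, ← h, ← hs_uncoupled 0 q v]
  simp [mag]

theorem act_plus_apply_of_lt (v : Matrix (Fin (a + 1)) (Fin (b + 1)) ℂ) (p : Fin (a + 1))
    (q : Fin (b + 1)) (hp : (p : ℕ) + 1 < a + 1) :
    act a b 0 v p q =
      ladderCoeff a p * v ⟨p + 1, hp⟩ q + ∑ q', jPlus b q q' * v p q' := by
  rw [act_apply, Finset.sum_eq_single (⟨p + 1, hp⟩ : Fin (a + 1))]
  · simp [jPlus_apply]
  · intro r _ hr
    have : (r : ℕ) ≠ p + 1 := fun h' => hr (Fin.ext h')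
    simp [jPlus_apply, this]
  · simp

variable {c : ℕ} {v u : Matrix (Fin (a + 1)) (Fin (b + 1)) ℂ}

/-- By weight, row `0` of `v` has at most the corner entry, and `J₊ v = 0` expresses row `k + 1`
through row `k`; so `v` vanishes row by row. If `j - j₁` is not an admissible magnetic number, row
`0` is zero by weight alone. -/
theorem IsTop.eq_zero_of_corner (hv : IsTop a b c v) (h : corner a b c v = 0) : v = 0 := by
  have key : ∀ (k : ℕ) (hk : k < a + 1) (q : Fin (b + 1)), v ⟨k, hk⟩ q = 0 := by
    intro k
    induction k with
    | zero =>
      intro hk q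
      by_cases hq : mag b q = (c : ℤ) - a
      · rw [← h, corner_eq c v q hq]
        rfl
      · refine apply_eq_zero_of_weight (x := c) (by simpa using hv.1) ?_
        simp only [mag]
        simp only [mag] at hq
        push_cast
        omega
    | succ k ih =>
      intro hk q
      have h1 := act_plus_apply_of_lt v ⟨k, by omega⟩ q hk
      rw [hv.2] at h1
      simp only [ih, mul_zero, Finset.sum_const_zero, add_zero, Matrix.zero_apply] at h1
      exact (mul_eq_zero.mp h1.symm).resolve_left (ladderCoeff_ne_zero (by simpa using hk))
  ext p q
  exact key p p.isLt q

theorem IsTop.eq_of_corner (hv : IsTop a b c v) (hu : IsTop a b c u) :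
    corner a b c u • v = corner a b c v • u := by
  rw [← sub_eq_zero]
  refine ((hv.smul _).sub (hu.smul _)).eq_zero_of_corner ?_
  simp only [corner, hs_sub_right, hs_smul_right]
  ring

theorem isCoupledTop_iff :
    IsCoupledTop a b c v ↔
      IsTop a b c v ∧ hs v v = 1 ∧ ∃ r : ℝ, 0 < r ∧ corner a b c v = r := by
  constructor
  · rintro ⟨h1, h2, h3, h4, h5⟩
    exact ⟨⟨h1, h2⟩, h3, _, h4, Complex.ext (by simp [corner]) (by simpa [corner] using h5)⟩
  · rintro ⟨⟨h1, h2⟩, h3, r, hr, h4⟩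
    rw [corner] at h4
    exact ⟨h1, h2, h3, by rw [h4]; simpa using hr, by rw [h4]; simp⟩

theorem IsCoupledTop.eq (hv : IsCoupledTop a b c v) (hu : IsCoupledTop a b c u) : v = u := by
  obtain ⟨hv, hv1, r, hr, hvr⟩ := isCoupledTop_iff.mp hv
  obtain ⟨hu, hu1, t, ht, hut⟩ := isCoupledTop_iff.mp hu
  have h := hv.eq_of_corner hu
  rw [hvr, hut] at h
  have h2 : hs ((t : ℂ) • v) ((t : ℂ) • v) = hs ((r : ℂ) • u) ((r : ℂ) • u) := by rw [h]
  simp only [hs_smul_left, hs_smul_right, hv1, hu1, Complex.star_def, Complex.conj_ofReal,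
    mul_one] at h2
  have h3 : t * t = r * r := by exact_mod_cast h2
  have h4 : t = r := by nlinarith
  subst h4
  exact smul_right_injective _ (show (t : ℂ) ≠ 0 by exact_mod_cast ht.ne') h

theorem IsCoupledTop.coupledTop_eq (hv : IsCoupledTop a b c v) : coupledTop a b c = v := by
  have h : ∃ v, IsCoupledTop a b c v := ⟨v, hv⟩
  rw [coupledTop, dif_pos h]
  exact h.choose_spec.eq hv

theorem coupledTop_eq_zero_or (a b c : ℕ) :
    coupledTop a b c = 0 ∨ IsCoupledTop a b c (coupledTop a b c) := by
  by_cases h : ∃ v, IsCoupledTop a b c v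
  · right
    rw [coupledTop, dif_pos h]
    exact h.choose_spec
  · left
    rw [coupledTop, dif_neg h]

theorem isTop_coupledTop (a b c : ℕ) : IsTop a b c (coupledTop a b c) := by
  rcases coupledTop_eq_zero_or a b c with h | h
  · rw [h]
    exact isTop_zero a b c
  · exact (isCoupledTop_iff.mp h).1

/-- A positive corner leaves no freedom of phase, so normalizing `v` yields the chosen coupled
vector. This also supplies the existence of that vector. -/
theorem IsTop.eq_sqrt_smul (hv : IsTop a b c v) {r t : ℝ} (hr : 0 < r)
    (hvr : corner a b c v = r) (hvt : hs v v = t) :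
    v = ((√t : ℝ) : ℂ) • coupledTop a b c ∧ hs (coupledTop a b c) (coupledTop a b c) = 1 := by
  obtain ⟨t', ht0, ht', hz⟩ := hs_self_eq_ofReal v
  obtain rfl : t' = t := by
    rw [ht'] at hvt
    exact_mod_cast hvt
  have ht : 0 < t' := by
    refine ht0.lt_of_ne fun h => ?_
    rw [hz h.symm, corner, hs_zero_right] at hvr
    exact hr.ne (by exact_mod_cast hvr)
  have hs0 : 0 < √t' := Real.sqrt_pos.mpr ht
  have hne : ((√t' : ℝ) : ℂ) ≠ 0 := by exact_mod_cast hs0.ne'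
  have hc : IsCoupledTop a b c (((√t' : ℝ) : ℂ)⁻¹ • v) := by
    rw [isCoupledTop_iff]
    refine ⟨hv.smul _, ?_, (√t')⁻¹ * r, by positivity, ?_⟩
    · rw [hs_smul_left, hs_smul_right, ht']
      have h1 : ((√t' : ℝ) : ℂ) * ((√t' : ℝ) : ℂ) = t' := by
        rw [← Complex.ofReal_mul, Real.mul_self_sqrt ht0]
      simp only [star_inv₀, Complex.star_def, Complex.conj_ofReal]
      field_simp
      rw [pow_two, h1]
    · rw [corner, hs_smul_right]
      rw [corner] at hvr
      rw [hvr]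
      push_cast
      rfl
  rw [hc.coupledTop_eq]
  refine ⟨?_, (isCoupledTop_iff.mp hc).2.1⟩
  rw [smul_smul, mul_inv_cancel₀ hne, one_smul]

/-- The second equation says that `R = 0` unless `coupledTop` is normalized. It replaces any
discussion of which spins occur in the tensor product. -/
theorem IsTop.exists_smul (hv : IsTop a b c v) :
    ∃ R : ℂ, v = R • coupledTop a b c ∧
      R * hs (coupledTop a b c) (coupledTop a b c) = R := by
  by_cases h0 : corner a b c v = 0
  · exact ⟨0, by rw [hv.eq_zero_of_corner h0, zero_smul], zero_mul _⟩
  · obtain ⟨t, -, ht, -⟩ := hs_self_eq_ofReal ((corner a b c v)⁻¹ • v)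
    have h1 : corner a b c ((corner a b c v)⁻¹ • v) = (1 : ℝ) := by
      conv_lhs => rw [corner, hs_smul_right]
      rw [Complex.ofReal_one]
      exact inv_mul_cancel₀ h0
    obtain ⟨h2, h3⟩ := (hv.smul (corner a b c v)⁻¹).eq_sqrt_smul one_pos h1 ht
    refine ⟨corner a b c v * ((√t : ℝ) : ℂ), ?_, by rw [h3, mul_one]⟩
    rw [mul_smul, ← h2, smul_smul, mul_inv_cancel₀ h0, one_smul]

/-- The Wigner-Eckart principle: since a spin has at most one copy in the product, a multiplet is
fixed up to a single scalar `R` that does not depend on the magnetic number. -/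
theorem IsMultiplet.exists_smul {w : ℕ → Matrix (Fin (a + 1)) (Fin (b + 1)) ℂ}
    (hw : IsMultiplet a b c w) :
    ∃ R : ℂ, (∀ k ≤ c, w k = R • coupledAux a b c k) ∧
      R * hs (coupledTop a b c) (coupledTop a b c) = R := by
  obtain ⟨R, h1, h2⟩ := hw.isTop.exists_smul
  refine ⟨R, fun k hk => ?_, h2⟩
  rw [hw.eq_ladder hk, h1, ladder_smul, coupledAux_eq_ladder]

theorem hs_coupledAux {c' k k' : ℕ} (hk : k ≤ c) (hk' : k' ≤ c') :
    hs (coupledAux a b c k) (coupledAux a b c' k') =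
      if c = c' ∧ k = k' then hs (coupledTop a b c) (coupledTop a b c) else 0 := by
  rw [coupledAux_eq_ladder, coupledAux_eq_ladder]
  split_ifs with h
  · obtain ⟨rfl, rfl⟩ := h
    exact (isTop_coupledTop a b c).hs_ladder_self hk
  · refine (isTop_coupledTop a b c).hs_ladder_of_ne (isTop_coupledTop a b c') hk hk' ?_
    by_contra! h'
    exact h h'

theorem coupled_mag (k : Fin (c + 1)) : coupled a b c (mag c k) = coupledAux a b c k := by
  have h1 : |mag c k| ≤ (c : ℤ) ∧ 2 ∣ (c : ℤ) - mag c k := by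
    rw [abs_le, mag]
    omega
  have h2 : (((c : ℤ) - mag c k) / 2).toNat = k := by
    rw [mag]
    omega
  rw [coupled, if_pos h1, h2]

theorem exists_mag_eq {z : ℤ} (h : |z| ≤ (c : ℤ) ∧ 2 ∣ (c : ℤ) - z) :
    ∃ k : Fin (c + 1), mag c k = z := by
  rw [abs_le] at h
  refine ⟨⟨(((c : ℤ) - z) / 2).toNat, by omega⟩, ?_⟩
  simp only [mag]
  omega

theorem clebschGordan_mag (p : Fin (a + 1)) (q : Fin (b + 1)) (z : ℤ) :
    clebschGordan a b c (mag a p) (mag b q) z = star (coupled a b c z p q) := by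
  rw [clebschGordan, ← star_hs, hs_uncoupled]

theorem coupledAux_apply_eq_zero {k : Fin (c + 1)} {p : Fin (a + 1)} {q : Fin (b + 1)}
    (h : mag a p + mag b q ≠ mag c k) : coupledAux a b c k p q = 0 := by
  refine apply_eq_zero_of_weight (x := mag c k) ?_ h
  rw [coupledAux_eq_ladder, (isTop_coupledTop a b c).act_three_ladder, mag]
  congr 1
  push_cast
  ring

theorem clebschGordan_eq_zero {x y z : ℤ} (h : x + y ≠ z) : clebschGordan a b c x y z = 0 := by
  rw [clebschGordan, hs_eq_sum]
  refine Finset.sum_eq_zero fun p _ => Finset.sum_eq_zero fun q _ => ?_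
  by_cases hz : |z| ≤ (c : ℤ) ∧ 2 ∣ (c : ℤ) - z
  · obtain ⟨k, rfl⟩ := exists_mag_eq hz
    rw [coupled_mag, uncoupled, of_apply]
    split_ifs with h1
    · rw [coupledAux_apply_eq_zero (by rw [h1.1, h1.2]; exact h), star_zero, zero_mul]
    · rw [mul_zero]
  · rw [coupled, if_neg hz, Matrix.zero_apply, star_zero, zero_mul]

/-- Summation over the intermediate magnetic number. -/
theorem sum_clebschGordan_mul (x y : ℤ) (f : ℤ → ℂ) :
    ∑ k : Fin (c + 1), clebschGordan a b c x y (mag c k) * f (mag c k) =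
      clebschGordan a b c x y (x + y) * f (x + y) := by
  by_cases hz : |x + y| ≤ (c : ℤ) ∧ 2 ∣ (c : ℤ) - (x + y)
  · obtain ⟨k, hk⟩ := exists_mag_eq hz
    rw [← hk]
    refine Finset.sum_eq_single k (fun i _ hi => ?_) (by simp)
    rw [clebschGordan_eq_zero, zero_mul]
    rw [← hk, Ne, mag_inj]
    exact hi.symm
  · rw [clebschGordan.eq_1 _ _ _ _ _ (x + y), coupled, if_neg hz, hs_zero_left, zero_mul]
    refine Finset.sum_eq_zero fun k _ => ?_
    rw [clebschGordan_eq_zero, zero_mul]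
    intro h
    rw [h, abs_le, mag] at hz
    omega

end Coupled

/-! ### The operator basis as coupled vectors -/

/-- The matrix of the identification of the spin `n / 2` with its dual. -/
def dual (n : ℕ) : Matrix (Fin (n + 1)) (Fin (n + 1)) ℂ :=
  Matrix.of fun p q => if q = p.rev then (-1) ^ (q : ℕ) else 0

theorem mul_dual_transpose_apply {n : ℕ} (X : Matrix (Fin (n + 1)) (Fin (n + 1)) ℂ)
    (p q : Fin (n + 1)) :
    (X * (dual n)ᵀ) p q = (-1) ^ (q.rev : ℕ) * X p q.rev := by
  rw [mul_apply, Finset.sum_eq_single q.rev]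
  · simp [dual, mul_comm]
  · intro r _ hr
    simp [dual, hr]
  · simp

theorem dual_mul_apply {n : ℕ} (X : Matrix (Fin (n + 1)) (Fin (n + 1)) ℂ)
    (p q : Fin (n + 1)) :
    (dual n * X) p q = (-1) ^ (p.rev : ℕ) * X p.rev q := by
  rw [mul_apply, Finset.sum_eq_single p.rev]
  · simp [dual]
  · intro r _ hr
    simp [dual, hr]
  · simp

theorem mul_dual_apply {n : ℕ} (X : Matrix (Fin (n + 1)) (Fin (n + 1)) ℂ)
    (p q : Fin (n + 1)) :
    (X * dual n) p q = (-1) ^ (q : ℕ) * X p q.rev := by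
  rw [mul_apply, Finset.sum_eq_single q.rev]
  · simp [dual, mul_comm]
  · intro r _ hr
    have : q ≠ r.rev := fun h => hr (by rw [h, Fin.rev_rev])
    simp [dual, this]
  · simp

theorem dual_mul_dual_transpose (n : ℕ) : dual n * (dual n)ᵀ = 1 := by
  ext p q
  rw [mul_dual_transpose_apply, one_apply]
  simp only [dual, of_apply, Fin.rev_inj]
  by_cases h : p = q
  · simp [h, ← mul_pow]
  · have h' : q ≠ p := fun e => h e.symm
    simp [h, h']

theorem dual_transpose_mul_dual (n : ℕ) : (dual n)ᵀ * dual n = 1 :=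
  mul_eq_one_comm.mp (dual_mul_dual_transpose n)

theorem dual_conjTranspose (n : ℕ) : (dual n)ᴴ = (dual n)ᵀ := by
  ext p q
  simp only [conjTranspose_apply, transpose_apply, dual, of_apply]
  split_ifs <;> simp

theorem dual_mul_jPlus (n : ℕ) : dual n * jPlus n = -(jMinus n * dual n) := by
  ext p q
  rw [Matrix.neg_apply, dual_mul_apply, mul_dual_apply, jPlus_apply, jMinus_apply]
  by_cases h : (q : ℕ) = p.rev + 1
  · have h' : (p : ℕ) = q.rev + 1 := by
      simp only [Fin.val_rev] at h ⊢
      omega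
    have h1 : ladderCoeff n p.rev = ladderCoeff n q.rev := by
      rw [Fin.val_rev] at h h' ⊢
      rw [Fin.val_rev]
      simp only [ladderCoeff]
      congr 2
      rw [show n + 1 - ((q : ℕ) + 1) = p - 1 by omega, show n + 1 - ((p : ℕ) + 1) = n - p by omega,
        Nat.cast_sub (by omega), Nat.cast_sub (by omega)]
      push_cast
      ring
    rw [if_pos h, if_pos h', h, h1, pow_succ]
    ring
  · have h' : ¬ (p : ℕ) = q.rev + 1 := by
      simp only [Fin.val_rev] at h ⊢
      omega
    rw [if_neg h, if_neg h', mul_zero, mul_zero, neg_zero]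

theorem dual_mul_jThree (n : ℕ) : dual n * jThree n = -(jThree n * dual n) := by
  ext p q
  rw [Matrix.neg_apply, jThree, mul_diagonal, diagonal_mul, dual, of_apply]
  split_ifs with h
  · rw [h, Fin.val_rev, show n + 1 - ((p : ℕ) + 1) = n - p by omega, Nat.cast_sub (by omega)]
    ring
  · simp

theorem dual_mul_gen (n : ℕ) (s : Fin 3) :
    dual n * gen n s = -(gen n (genSwap s) * dual n) := by
  fin_cases s
  · exact dual_mul_jPlus n
  -- Transposing the `J₊` relation gives one for `(dual n)ᵀ`; orthogonality of `dual n` moves it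
  -- back to `dual n`.
  · have h := congrArg transpose (dual_mul_jPlus n)
    rw [transpose_mul, transpose_neg, transpose_mul, jMinus_transpose] at h
    change jMinus n * (dual n)ᵀ = -((dual n)ᵀ * jPlus n) at h
    change dual n * jMinus n = -(jPlus n * dual n)
    calc dual n * jMinus n = dual n * (jMinus n * (dual n)ᵀ) * dual n := by
          rw [Matrix.mul_assoc, Matrix.mul_assoc, dual_transpose_mul_dual, Matrix.mul_one]
      _ = -((dual n * (dual n)ᵀ) * jPlus n * dual n) := by
          rw [h, Matrix.mul_neg, Matrix.neg_mul, Matrix.mul_assoc, Matrix.mul_assoc,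
            Matrix.mul_assoc, Matrix.mul_assoc]
      _ = _ := by rw [dual_mul_dual_transpose, Matrix.one_mul]
  · exact dual_mul_jThree n

theorem dual_transpose_mul_gen (n : ℕ) (s : Fin 3) :
    (dual n)ᵀ * (gen n s)ᵀ = -(gen n s * (dual n)ᵀ) := by
  have h := congrArg transpose (dual_mul_gen n (genSwap s))
  rw [transpose_mul, transpose_neg, transpose_mul, gen_transpose, gen_transpose] at h
  have h2 : genSwap (genSwap s) = s := by fin_cases s <;> rfl
  rw [h2] at h
  rw [gen_transpose, h, neg_neg]

/-- Passing `(dual n)ᵀ` across a transposed generator produces a minus sign, which turns the tensor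
action into the commutator. -/
theorem act_mul_dual (n : ℕ) (s : Fin 3) (X : Matrix (Fin (n + 1)) (Fin (n + 1)) ℂ) :
    act n n s (X * (dual n)ᵀ) = (gen n s * X - X * gen n s) * (dual n)ᵀ := by
  rw [act, tensorAct, Matrix.mul_assoc X, dual_transpose_mul_gen, Matrix.sub_mul,
    Matrix.mul_neg, Matrix.mul_assoc, Matrix.mul_assoc, sub_eq_add_neg]

theorem mul_dual_cancel {n : ℕ} {X Y : Matrix (Fin (n + 1)) (Fin (n + 1)) ℂ}
    (h : X * (dual n)ᵀ = Y * (dual n)ᵀ) : X = Y := by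
  have h2 := congrArg (· * dual n) h
  simpa only [Matrix.mul_assoc, dual_transpose_mul_dual, Matrix.mul_one] using h2

theorem hs_mul_dual {n : ℕ} (X Y : Matrix (Fin (n + 1)) (Fin (n + 1)) ℂ) :
    hs (X * (dual n)ᵀ) (Y * (dual n)ᵀ) = hs X Y := by
  rw [hs, hs, ← dual_conjTranspose, conjTranspose_mul, conjTranspose_conjTranspose,
    Matrix.mul_assoc, trace_mul_comm, ← Matrix.mul_assoc, Matrix.mul_assoc, dual_conjTranspose,
    Matrix.mul_assoc, dual_transpose_mul_dual, Matrix.mul_one]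

theorem opBasisAux_zero (n l : ℕ) :
    opBasisAux n l 0 = ((-1 : ℂ) ^ l / ((opNorm n l : ℝ) : ℂ)) • jPlus n ^ l := rfl

theorem opBasisAux_succ (n l k : ℕ) :
    opBasisAux n l (k + 1) = (1 / ladderCoeff (2 * l) k) •
      (jMinus n * opBasisAux n l k - opBasisAux n l k * jMinus n) := by
  rw [opBasisAux, ladderCoeff]
  push_cast
  rfl

theorem opBasisAux_mul_dual (n l k : ℕ) :
    opBasisAux n l k * (dual n)ᵀ = ladder n n (2 * l) (opBasisAux n l 0 * (dual n)ᵀ) k := by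
  induction k with
  | zero => rfl
  | succ k ih => rw [ladder_succ, ← ih, act_mul_dual, opBasisAux_succ, Matrix.smul_mul]; rfl

theorem commutator_jThree_pow (n l : ℕ) :
    jThree n * jPlus n ^ l - jPlus n ^ l * jThree n = (l : ℂ) • jPlus n ^ l := by
  induction l with
  | zero => simp
  | succ l ih =>
    have h : jThree n * jPlus n ^ (l + 1) - jPlus n ^ (l + 1) * jThree n =
        (jThree n * jPlus n ^ l - jPlus n ^ l * jThree n) * jPlus n +
          jPlus n ^ l * (jThree n * jPlus n - jPlus n * jThree n) := by
      rw [pow_succ]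
      noncomm_ring
    rw [h, ih, commutator_jThree_jPlus, Matrix.smul_mul, ← pow_succ]
    push_cast
    module

theorem isTop_opBasisAux (n l : ℕ) : IsTop n n (2 * l) (opBasisAux n l 0 * (dual n)ᵀ) := by
  refine ⟨?_, ?_⟩
  · rw [act_mul_dual, opBasisAux_zero, gen_two, Matrix.mul_smul, Matrix.smul_mul, ← smul_sub,
      commutator_jThree_pow, smul_comm, Matrix.smul_mul]
    congr 1
    push_cast
    ring
  · rw [act_mul_dual, opBasisAux_zero, gen_zero, Matrix.mul_smul, Matrix.smul_mul, ← smul_sub,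
      ← pow_succ, ← pow_succ', sub_self, smul_zero, Matrix.zero_mul]

/-- The operators `e^j(l, l - i)` form a tensor operator of rank `l`. -/
theorem commutator_gen_opBasisAux (n l : ℕ) (s : Fin 3) (i : Fin (2 * l + 1)) :
    gen n s * opBasisAux n l i - opBasisAux n l i * gen n s =
      ∑ k : Fin (2 * l + 1), gen (2 * l) s k i • opBasisAux n l k := by
  apply mul_dual_cancel
  rw [← act_mul_dual, opBasisAux_mul_dual n l i, (isTop_opBasisAux n l).isMultiplet_ladder,
    Finset.sum_mul]
  refine Finset.sum_congr rfl fun k _ => ?_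
  rw [Matrix.smul_mul, opBasisAux_mul_dual n l k]

theorem jPlus_pow_apply {n l : ℕ} (h : l < n + 1) :
    ∃ r : ℝ, 0 < r ∧ (jPlus n ^ l) 0 ⟨l, h⟩ = r := by
  induction l with
  | zero => exact ⟨1, one_pos, by simp⟩
  | succ l ih =>
    obtain ⟨r, hr, e⟩ := ih (by omega)
    obtain ⟨t, ht, e'⟩ := ladderCoeff_eq_ofReal_pos (show l < n by omega)
    refine ⟨r * t, by positivity, ?_⟩
    rw [pow_succ, mul_apply, Finset.sum_eq_single (⟨l, by omega⟩ : Fin (n + 1))]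
    · rw [e, jPlus_apply]
      simp [e']
    · intro i _ hi
      have : l ≠ i := fun h' => hi (Fin.ext h'.symm)
      simp [jPlus_apply, this]
    · simp

theorem opNorm_pos {n l : ℕ} (h : l ≤ n) :
    0 < opNorm n l ∧ hs (jPlus n ^ l) (jPlus n ^ l) = ((opNorm n l ^ 2 : ℝ) : ℂ) := by
  obtain ⟨t, ht0, ht, hz⟩ := hs_self_eq_ofReal (jPlus n ^ l)
  obtain ⟨r, hr, e⟩ := jPlus_pow_apply (show l < n + 1 by omega)
  have hne : t ≠ 0 := by
    intro h0
    rw [hz h0, Matrix.zero_apply] at e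
    exact hr.ne (by exact_mod_cast e)
  have h1 : jMinus n = (jPlus n)ᴴ := (gen_conjTranspose n 0).symm
  have h2 : opNorm n l = √t := by
    rw [opNorm, h1, ← conjTranspose_pow, ← hs, ht, Complex.ofReal_re]
  rw [h2, Real.sq_sqrt ht0]
  exact ⟨Real.sqrt_pos.mpr (ht0.lt_of_ne hne.symm), ht⟩

/-- The sign of the nonzero entry in the first row of `e^j(l, l - k)`. -/
theorem opBasisAux_first_row {n l k : ℕ} (hl : l ≤ n) (hk : k ≤ l) :
    ∃ r : ℝ, 0 < r ∧ opBasisAux n l k 0 ⟨l - k, by omega⟩ = (-1) ^ (l + k) * (r : ℂ) := by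
  induction k with
  | zero =>
    obtain ⟨r, hr, e⟩ := jPlus_pow_apply (show l < n + 1 by omega)
    have h0 := (opNorm_pos hl).1
    refine ⟨r / opNorm n l, by positivity, ?_⟩
    rw [opBasisAux_zero, Matrix.smul_apply]
    simp only [Nat.sub_zero, e, smul_eq_mul, add_zero]
    push_cast
    ring
  | succ k ih =>
    obtain ⟨r, hr, e⟩ := ih (by omega)
    obtain ⟨t, ht, e'⟩ := ladderCoeff_eq_ofReal_pos (show k < 2 * l by omega)
    obtain ⟨u, hu, e''⟩ := ladderCoeff_eq_ofReal_pos (show l - (k + 1) < n by omega)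
    refine ⟨r * u / t, by positivity, ?_⟩
    -- Row `0` of `J₋` is zero, so only `-e J₋` contributes to the first row of the commutator:
    -- every lowering step flips the sign.
    rw [opBasisAux_succ, Matrix.smul_apply, Matrix.sub_apply, mul_apply, mul_apply,
      Finset.sum_eq_zero, Finset.sum_eq_single (⟨l - k, by omega⟩ : Fin (n + 1)), e, e',
      jMinus_apply]
    · rw [if_pos (by simp only; omega), e'']
      push_cast
      rw [← add_assoc, pow_succ, smul_eq_mul]
      ring
    · intro i _ hi
      have : (i : ℕ) ≠ l - (k + 1) + 1 := fun h' => hi (Fin.ext (by simp only; omega))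
      simp [jMinus_apply, this]
    · simp
    · intro i _
      simp [jMinus_apply]

theorem isCoupledTop_opBasisAux {n l : ℕ} (hl : l ≤ n) :
    IsCoupledTop n n (2 * l) (opBasisAux n l 0 * (dual n)ᵀ) := by
  rw [isCoupledTop_iff]
  refine ⟨isTop_opBasisAux n l, ?_, ?_⟩
  · obtain ⟨h1, h2⟩ := opNorm_pos hl
    have h3 : ((opNorm n l : ℝ) : ℂ) ≠ 0 := by exact_mod_cast h1.ne'
    rw [hs_mul_dual, opBasisAux_zero, hs_smul_left, hs_smul_right, h2]
    simp only [star_div₀, star_pow, star_neg, star_one, Complex.star_def, Complex.conj_ofReal]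
    push_cast
    field_simp
    rw [← pow_mul, mul_comm l 2, pow_mul]
    simp
  · obtain ⟨r, hr, e⟩ := opBasisAux_first_row hl (Nat.zero_le l)
    refine ⟨r, hr, ?_⟩
    have hq : (⟨n - l, by omega⟩ : Fin (n + 1)).rev = ⟨l - 0, by omega⟩ := by
      rw [Fin.ext_iff, Fin.val_rev]
      simp only
      omega
    -- The corner is column `n - l`, which reversal sends to `l`. The sign `(-1)^l` of `dual n`
    -- there cancels the `(-1)^l` in the definition of `e^j(l,l)`.
    rw [corner_eq _ _ ⟨n - l, by omega⟩ (by simp only [mag]; push_cast; omega),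
      mul_dual_transpose_apply, hq, e, ← mul_assoc, ← pow_add]
    simp [← two_mul]

theorem coupledAux_eq_opBasisAux {n l : ℕ} (hl : l ≤ n) (k : ℕ) :
    coupledAux n n (2 * l) k = opBasisAux n l k * (dual n)ᵀ := by
  rw [coupledAux_eq_ladder, (isCoupledTop_opBasisAux hl).coupledTop_eq, ← opBasisAux_mul_dual]

theorem hs_opBasisAux {n l l' k k' : ℕ} (hl : l ≤ n) (hl' : l' ≤ n) (hk : k ≤ 2 * l)
    (hk' : k' ≤ 2 * l') :
    hs (opBasisAux n l k) (opBasisAux n l' k') = if l = l' ∧ k = k' then 1 else 0 := by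
  rw [← hs_mul_dual, ← coupledAux_eq_opBasisAux hl, ← coupledAux_eq_opBasisAux hl',
    hs_coupledAux hk hk', (isCoupledTop_opBasisAux hl).coupledTop_eq,
    (isCoupledTop_iff.mp (isCoupledTop_opBasisAux hl)).2.1]
  simp

theorem conjTranspose_opBasisAux (n l k : ℕ) : (opBasisAux n l k)ᴴ = (opBasisAux n l k)ᵀ := by
  have hp : (jPlus n)ᴴ = (jPlus n)ᵀ := (gen_conjTranspose n 0).trans (gen_transpose n 0).symm
  have hm : (jMinus n)ᴴ = (jMinus n)ᵀ := (gen_conjTranspose n 1).trans (gen_transpose n 1).symm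
  induction k with
  | zero =>
    rw [opBasisAux_zero, conjTranspose_smul, transpose_smul, conjTranspose_pow, transpose_pow, hp]
    congr 1
    simp
  | succ k ih =>
    rw [opBasisAux_succ, conjTranspose_smul, transpose_smul, conjTranspose_sub, transpose_sub,
      conjTranspose_mul, conjTranspose_mul, transpose_mul, transpose_mul, ih, hm, star_div₀,
      star_one, star_ladderCoeff]

theorem star_opBasisAux_apply (n l k : ℕ) (p q : Fin (n + 1)) :
    star (opBasisAux n l k p q) = opBasisAux n l k p q := by
  have h := congrFun (congrFun (conjTranspose_opBasisAux n l k) q) p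
  simpa using h

/-! ### The Wigner-Eckart theorem for the matrix entries of the operator basis -/

/-- For a fixed row `k`, the entries of the operators `e^j(l, l - i)` as a vector in the tensor
product of the spins `l` and `n / 2`. -/
noncomputable def rowVector (n l k : ℕ) : Matrix (Fin (2 * l + 1)) (Fin (n + 1)) ℂ :=
  Matrix.of fun i q => if h : k < n + 1 then opBasisAux n l i ⟨k, h⟩ q else 0

theorem rowVector_apply (n l : ℕ) (k : Fin (n + 1)) (i : Fin (2 * l + 1)) (q : Fin (n + 1)) :
    rowVector n l k i q = opBasisAux n l i k q := by
  simp [rowVector, k.isLt]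

/-- The entry `(k, q)` of the commutator relation for the transposed generator. Transposing moves
the action from the row index to the pair of operator index and column index. -/
theorem sum_gen_mul_opBasisAux (n l : ℕ) (s : Fin 3) (i : Fin (2 * l + 1)) (k q : Fin (n + 1)) :
    ∑ i' : Fin (2 * l + 1), gen (2 * l) s i i' * opBasisAux n l i' k q +
        ∑ q' : Fin (n + 1), gen n s q q' * opBasisAux n l i k q' =
      ∑ k' : Fin (n + 1), gen n s k' k * opBasisAux n l i k' q := by
  have h := congrFun (congrFun (commutator_gen_opBasisAux n l (genSwap s) i) k) q
  rw [Matrix.sub_apply, mul_apply, mul_apply, Matrix.sum_apply] at h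
  simp only [Matrix.smul_apply, smul_eq_mul, gen_swap_apply] at h
  rw [← h]
  simp only [mul_comm, sub_add_cancel]

theorem isMultiplet_rowVector (n l : ℕ) : IsMultiplet (2 * l) n n (rowVector n l) := by
  intro s k
  ext i q
  rw [act_apply, Matrix.sum_apply]
  simp only [Matrix.smul_apply, smul_eq_mul, rowVector_apply]
  exact sum_gen_mul_opBasisAux n l s i k q

theorem isMultiplet_rowVector_transpose (n l : ℕ) :
    IsMultiplet n (2 * l) n (fun k => (rowVector n l k)ᵀ) := by
  intro s k
  ext q i
  rw [act_apply, Matrix.sum_apply, add_comm]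
  simp only [Matrix.smul_apply, smul_eq_mul, transpose_apply, rowVector_apply]
  exact sum_gen_mul_opBasisAux n l s i k q

theorem hs_transpose {a b : ℕ} (P Q : Matrix (Fin a) (Fin b) ℂ) : hs Pᵀ Qᵀ = hs P Q := by
  simp only [hs_eq_sum, transpose_apply]
  exact Finset.sum_comm

theorem IsMultiplet.hs_self {a b c : ℕ} {w : ℕ → Matrix (Fin (a + 1)) (Fin (b + 1)) ℂ}
    (hw : IsMultiplet a b c w) {k : ℕ} (hk : k ≤ c) : hs (w k) (w k) = hs (w 0) (w 0) := by
  rw [hw.eq_ladder hk, hw.isTop.hs_ladder_self hk]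

/-- The rows form a multiplet and have equal norms; together they carry the `2l + 1` unit norms of
the operators, shared among `n + 1` rows. -/
theorem hs_rowVector {n l : ℕ} (hl : l ≤ n) (k : Fin (n + 1)) :
    hs (rowVector n l k) (rowVector n l k) = (((2 * l + 1) / (n + 1) : ℝ) : ℂ) := by
  have h : ∑ k : Fin (n + 1), hs (rowVector n l k) (rowVector n l k) = 2 * (l : ℂ) + 1 := by
    have h1 : ∀ i : Fin (2 * l + 1), hs (opBasisAux n l i) (opBasisAux n l i) = 1 := fun i => by
      rw [hs_opBasisAux hl hl (by omega) (by omega)]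
      simp
    have h2 : ∑ i : Fin (2 * l + 1), hs (opBasisAux n l i) (opBasisAux n l i) =
        2 * (l : ℂ) + 1 := by
      simp [h1]
    rw [← h2]
    simp only [hs_eq_sum, rowVector_apply]
    exact Finset.sum_comm
  have h3 : ∀ k' : Fin (n + 1), hs (rowVector n l k') (rowVector n l k') =
      hs (rowVector n l k) (rowVector n l k) := fun k' => by
    rw [(isMultiplet_rowVector n l).hs_self (show (k' : ℕ) ≤ n by omega),
      (isMultiplet_rowVector n l).hs_self (show (k : ℕ) ≤ n by omega)]
  simp only [h3, Finset.sum_const, Finset.card_univ, Fintype.card_fin, nsmul_eq_mul] at h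
  have h4 : (n : ℂ) + 1 ≠ 0 := by exact_mod_cast n.succ_ne_zero
  push_cast at h ⊢
  rw [eq_div_iff h4, mul_comm, h]

/-- The factor `√((2j + 1) / (2l + 1))`, `n = 2j`. -/
noncomputable def reduced (n l : ℕ) : ℝ := √(((n : ℝ) + 1) / (2 * l + 1))

theorem sqrt_mul_reduced (n l : ℕ) :
    ((reduced n l : ℝ) : ℂ) * ((√((2 * l + 1) / (n + 1) : ℝ) : ℝ) : ℂ) = 1 := by
  rw [← Complex.ofReal_mul, reduced, ← Real.sqrt_mul (by positivity)]
  have : ((n : ℝ) + 1) / (2 * l + 1) * ((2 * l + 1) / (n + 1)) = 1 := by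
    field_simp
  rw [this]
  simp

/-- Here the corner is the entry `(0, l)` of `e^j(l,l)`, whose sign is `(-1)^l`. -/
theorem coupledAux_left {n l : ℕ} (hl : l ≤ n) (k : Fin (n + 1)) (i : Fin (2 * l + 1))
    (q : Fin (n + 1)) :
    coupledAux (2 * l) n n k i q = (-1) ^ l * (reduced n l : ℂ) * opBasisAux n l i k q := by
  have hw := isMultiplet_rowVector n l
  obtain ⟨r, hr, e⟩ := opBasisAux_first_row hl (Nat.zero_le l)
  have hc : corner (2 * l) n n ((-1 : ℂ) ^ l • rowVector n l 0) = r := by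
    rw [corner_eq _ _ ⟨l, by omega⟩ (by simp only [mag]; push_cast; ring), Matrix.smul_apply]
    have h1 := rowVector_apply n l 0 0 ⟨l, by omega⟩
    simp only [Fin.val_zero, Nat.sub_zero, add_zero] at h1 e
    rw [h1, e, smul_eq_mul, ← mul_assoc, ← mul_pow]
    simp
  have ht : hs ((-1 : ℂ) ^ l • rowVector n l 0) ((-1 : ℂ) ^ l • rowVector n l 0) =
      (((2 * l + 1) / (n + 1) : ℝ) : ℂ) := by
    rw [← hs_rowVector hl 0, hs_smul_left, hs_smul_right, ← mul_assoc]
    simp [← mul_pow]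
  have h := ((hw.isTop.smul _).eq_sqrt_smul hr hc ht).1
  have h2 : (-1 : ℂ) ^ l • rowVector n l k =
      ((√((2 * l + 1) / (n + 1) : ℝ) : ℝ) : ℂ) • coupledAux (2 * l) n n k := by
    rw [hw.eq_ladder (show (k : ℕ) ≤ n by omega), ← ladder_smul, h, ladder_smul,
      coupledAux_eq_ladder]
  have h3 := congrArg (fun X => (reduced n l : ℂ) • X) h2
  simp only [smul_smul, sqrt_mul_reduced, one_smul] at h3
  rw [← h3, Matrix.smul_apply, rowVector_apply, smul_eq_mul]
  ring

/-- With the spin `j` first, the corner is the entry `(0, 0)` of `e^j(l,0)`, which is positive;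
hence no sign, in contrast to `coupledAux_left`. -/
theorem coupledAux_right {n l : ℕ} (hl : l ≤ n) (k : Fin (n + 1)) (i : Fin (2 * l + 1))
    (q : Fin (n + 1)) :
    coupledAux n (2 * l) n k q i = (reduced n l : ℂ) * opBasisAux n l i k q := by
  have hw := isMultiplet_rowVector_transpose n l
  obtain ⟨r, hr, e⟩ := opBasisAux_first_row hl le_rfl
  have hc : corner n (2 * l) n (rowVector n l 0)ᵀ = r := by
    rw [corner_eq _ _ ⟨l, by omega⟩ (by simp only [mag]; push_cast; ring), transpose_apply]
    have h1 := rowVector_apply n l 0 ⟨l, by omega⟩ 0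
    simp only [Fin.val_zero, Nat.sub_self] at h1 e
    rw [h1]
    refine e.trans ?_
    simp [← two_mul]
  have ht : hs (rowVector n l 0)ᵀ (rowVector n l 0)ᵀ = (((2 * l + 1) / (n + 1) : ℝ) : ℂ) := by
    rw [← hs_rowVector hl 0, hs_transpose]
    rfl
  have h := (hw.isTop.eq_sqrt_smul hr hc ht).1
  have h2 : (rowVector n l k)ᵀ =
      ((√((2 * l + 1) / (n + 1) : ℝ) : ℝ) : ℂ) • coupledAux n (2 * l) n k := by
    rw [hw.eq_ladder (show (k : ℕ) ≤ n by omega), h, ladder_smul, coupledAux_eq_ladder]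
  have h3 := congrArg (fun X => (reduced n l : ℂ) • X) h2
  simp only [smul_smul, sqrt_mul_reduced, one_smul] at h3
  rw [← h3, Matrix.smul_apply, transpose_apply, rowVector_apply, smul_eq_mul]

/-! ### Completeness -/

theorem linearIndependent_opBasisAux (n : ℕ) :
    LinearIndependent ℂ
      (fun x : (Σ l : Fin (n + 1), Fin (2 * (l : ℕ) + 1)) => opBasisAux n x.1 x.2) := by
  rw [Fintype.linearIndependent_iff]
  rintro g hg ⟨l, i⟩
  have h := congrArg (hs (opBasisAux n l i)) hg
  rw [hs_zero_right, hs_sum_right, Finset.sum_eq_single ⟨l, i⟩] at h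
  · rwa [hs_smul_right, hs_opBasisAux (by omega) (by omega) (by omega) (by omega), if_pos ⟨rfl, rfl⟩,
      mul_one] at h
  · rintro ⟨l', i'⟩ - hne
    rw [hs_smul_right, hs_opBasisAux (by omega) (by omega) (by omega) (by omega), if_neg, mul_zero]
    rintro ⟨h1, h2⟩
    obtain rfl : l = l' := Fin.ext h1
    obtain rfl : i = i' := Fin.ext h2
    exact hne rfl
  · simp

theorem span_opBasisAux (n : ℕ) :
    Submodule.span ℂ (Set.range
      (fun x : (Σ l : Fin (n + 1), Fin (2 * (l : ℕ) + 1)) => opBasisAux n x.1 x.2)) = ⊤ := by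
  -- What remains is the dimension count `∑_{l ≤ n} (2l + 1) = (n + 1)²`.
  refine (linearIndependent_opBasisAux n).span_eq_top_of_card_eq_finrank' ?_
  rw [Module.finrank_matrix, Module.finrank_self, Fintype.card_sigma]
  simp only [Fintype.card_fin, mul_one]
  rw [Fin.sum_univ_eq_sum_range (fun l => 2 * l + 1) (n + 1)]
  induction n with
  | zero => rfl
  | succ n ih =>
    rw [Finset.sum_range_succ, ih]
    ring

theorem eq_sum_opBasisAux {n : ℕ} (X : Matrix (Fin (n + 1)) (Fin (n + 1)) ℂ) :
    X = ∑ l ∈ Finset.range (n + 1), ∑ i : Fin (2 * l + 1),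
      hs (opBasisAux n l i) X • opBasisAux n l i := by
  have hX : X ∈ Submodule.span ℂ (Set.range
      (fun x : (Σ l : Fin (n + 1), Fin (2 * (l : ℕ) + 1)) => opBasisAux n x.1 x.2)) := by
    rw [span_opBasisAux]
    trivial
  obtain ⟨c, hc⟩ := (Submodule.mem_span_range_iff_exists_fun ℂ).mp hX
  have h : ∀ x : (Σ l : Fin (n + 1), Fin (2 * (l : ℕ) + 1)),
      hs (opBasisAux n x.1 x.2) X = c x := by
    rintro ⟨l, i⟩
    rw [← hc, hs_sum_right, Finset.sum_eq_single ⟨l, i⟩]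
    · rw [hs_smul_right, hs_opBasisAux (by omega) (by omega) (by omega) (by omega),
        if_pos ⟨rfl, rfl⟩, mul_one]
    · rintro ⟨l', i'⟩ - hne
      rw [hs_smul_right, hs_opBasisAux (by omega) (by omega) (by omega) (by omega), if_neg,
        mul_zero]
      rintro ⟨h1, h2⟩
      obtain rfl : l = l' := Fin.ext h1
      obtain rfl : i = i' := Fin.ext h2
      exact hne rfl
    · simp
  rw [← Fin.sum_univ_eq_sum_range (fun l => ∑ i : Fin (2 * l + 1),
      hs (opBasisAux n l i) X • opBasisAux n l i) (n + 1), ← Fintype.sum_sigma']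
  conv_lhs => rw [← hc]
  refine Finset.sum_congr rfl fun x _ => ?_
  rw [h x]

/-! ### Transposition -/

theorem gen_rev_apply {n : ℕ} (s : Fin 3) (i k : Fin (n + 1)) :
    (-1 : ℂ) ^ (i : ℕ) * gen n s i k = -((-1) ^ (k : ℕ) * gen n (genSwap s) i.rev k.rev) := by
  have h := congrFun (congrFun (dual_mul_gen n s) i.rev) k
  rwa [Matrix.neg_apply, dual_mul_apply, mul_dual_apply, Fin.rev_rev] at h

/-- Transposition turns the representation into its dual; reversing the order with alternating signs
identifies the dual of spin `l` with spin `l`. -/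
theorem isMultiplet_transpose (n l : ℕ) :
    IsMultiplet n n (2 * l)
      (fun k => ((-1 : ℂ) ^ (l + k) • (opBasisAux n l (2 * l - k))ᵀ) * (dual n)ᵀ) := by
  intro s k
  have hrev : ∀ i : Fin (2 * l + 1), 2 * l - (i : ℕ) = i.rev := fun i => by
    rw [Fin.val_rev]
    omega
  have h1 : gen n s * (opBasisAux n l k.rev)ᵀ - (opBasisAux n l k.rev)ᵀ * gen n s =
      -∑ i : Fin (2 * l + 1), gen (2 * l) (genSwap s) i.rev k.rev • (opBasisAux n l i.rev)ᵀ := by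
    have h2 := congrArg transpose (commutator_gen_opBasisAux n l (genSwap s) k.rev)
    rw [transpose_sub, transpose_mul, transpose_mul, transpose_sum, gen_transpose,
      show genSwap (genSwap s) = s by fin_cases s <;> rfl] at h2
    rw [← neg_sub, h2, ← Equiv.sum_comp Fin.revPerm]
    rfl
  simp only [hrev]
  rw [act_mul_dual, Matrix.mul_smul, Matrix.smul_mul, ← smul_sub, h1, ← Finset.sum_neg_distrib,
    Finset.smul_sum, Finset.sum_mul]
  refine Finset.sum_congr rfl fun i _ => ?_
  rw [← Matrix.smul_mul, smul_smul, ← neg_smul, smul_smul]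
  congr 2
  rw [pow_add, pow_add]
  linear_combination -(-1 : ℂ) ^ l * gen_rev_apply s i k

theorem transpose_opBasisAux {n l k : ℕ} (hl : l ≤ n) (hk : k ≤ 2 * l) :
    (opBasisAux n l (2 * l - k))ᵀ = (-1 : ℂ) ^ (l + k) • opBasisAux n l k := by
  obtain ⟨R, hR, -⟩ := (isMultiplet_transpose n l).exists_smul
  have h : ∀ k ≤ 2 * l, (-1 : ℂ) ^ (l + k) • (opBasisAux n l (2 * l - k))ᵀ =
      R • opBasisAux n l k := fun k hk => by
    apply mul_dual_cancel
    rw [hR k hk, coupledAux_eq_opBasisAux hl, Matrix.smul_mul]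
  -- The scalar is read off from the entry `(0, 0)` of `e^j(l,0)`, which transposition fixes and
  -- which is nonzero.
  have hR1 : R = 1 := by
    obtain ⟨r, hr, e⟩ := opBasisAux_first_row hl le_rfl
    have e1 : opBasisAux n l l 0 0 ≠ 0 := by
      simp only [Nat.sub_self] at e
      refine e.trans_ne ?_
      have : (r : ℂ) ≠ 0 := by exact_mod_cast hr.ne'
      simp [this]
    have h2 := congrFun (congrFun (h l (by omega)) 0) 0
    rw [Matrix.smul_apply, Matrix.smul_apply, transpose_apply, show 2 * l - l = l by omega,
      smul_eq_mul, smul_eq_mul] at h2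
    have h3 := mul_right_cancel₀ e1 h2
    rw [← h3]
    simp [← two_mul]
  have h2 := congrArg (fun X => (-1 : ℂ) ^ (l + k) • X) (h k hk)
  simp only [smul_smul, hR1, mul_one, ← mul_pow] at h2
  simpa using h2

/-- The map `X ↦ dual * Xᵀ * dualᵀ` is an antiautomorphism taking each generator to its negative. It
gives `(-1)^l` on `J₊^l`; on `[J₋, X]` the reversal of order and the minus sign cancel, so the sign
persists down the ladder. -/
theorem dual_conj_opBasisAux (n l k : ℕ) :
    dual n * (opBasisAux n l k)ᵀ * (dual n)ᵀ = (-1 : ℂ) ^ l • opBasisAux n l k := by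
  have hmul : ∀ X Y : Matrix (Fin (n + 1)) (Fin (n + 1)) ℂ,
      dual n * (X * Y)ᵀ * (dual n)ᵀ =
        (dual n * Yᵀ * (dual n)ᵀ) * (dual n * Xᵀ * (dual n)ᵀ) := fun X Y => by
    rw [transpose_mul]
    calc dual n * (Yᵀ * Xᵀ) * (dual n)ᵀ = dual n * Yᵀ * 1 * Xᵀ * (dual n)ᵀ := by
          simp only [Matrix.mul_assoc, Matrix.one_mul]
      _ = _ := by
          rw [← dual_transpose_mul_dual]
          simp only [Matrix.mul_assoc]
  have hgen : ∀ s, dual n * (gen n s)ᵀ * (dual n)ᵀ = -gen n s := fun s => by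
    rw [gen_transpose, dual_mul_gen, show genSwap (genSwap s) = s by fin_cases s <;> rfl,
      Matrix.neg_mul, Matrix.mul_assoc, dual_mul_dual_transpose, Matrix.mul_one]
  have hp : ∀ l, dual n * (jPlus n ^ l)ᵀ * (dual n)ᵀ = (-1 : ℂ) ^ l • jPlus n ^ l := fun l => by
    induction l with
    | zero => simp [dual_mul_dual_transpose]
    | succ l ih =>
      rw [pow_succ', hmul, ih, ← gen_zero, hgen, Matrix.mul_neg, Matrix.smul_mul, ← pow_succ,
        ← pow_succ', pow_succ (-1 : ℂ)]
      simp
  induction k with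
  | zero =>
    rw [opBasisAux_zero, transpose_smul, Matrix.mul_smul, Matrix.smul_mul, hp, smul_comm]
  | succ k ih =>
    rw [opBasisAux_succ, transpose_smul, Matrix.mul_smul, Matrix.smul_mul, transpose_sub,
      Matrix.mul_sub, Matrix.sub_mul, hmul, hmul, ih, ← gen_one, hgen, smul_comm]
    congr 1
    simp only [Matrix.mul_neg, Matrix.neg_mul, Matrix.smul_mul, Matrix.mul_smul]
    module

/-! ### Passage from ladder positions to integral magnetic numbers -/

theorem neg_one_zpow_congr {x y : ℤ} (h : 2 ∣ x - y) : (-1 : ℂ) ^ x = (-1) ^ y := by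
  obtain ⟨k, hk⟩ := h
  rw [show x = y + 2 * k by omega, zpow_add₀ (by simp), _root_.zpow_mul]
  simp

theorem exists_index {l : ℕ} {m : ℤ} (h : |m| ≤ (l : ℤ)) :
    ∃ i : Fin (2 * l + 1), m = (l : ℤ) - (i : ℕ) := by
  rw [abs_le] at h
  refine ⟨⟨((l : ℤ) - m).toNat, by omega⟩, ?_⟩
  simp only
  omega

theorem opBasis_sub (n : ℕ) {l i : ℕ} (h : i ≤ 2 * l) :
    opBasis n l ((l : ℤ) - i) = opBasisAux n l i := by
  rw [opBasis, if_pos (by rw [abs_le]; omega)]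
  congr
  omega

theorem opBasis_of_lt (n : ℕ) {l : ℕ} {m : ℤ} (h : ¬|m| ≤ (l : ℤ)) : opBasis n l m = 0 :=
  if_neg h

theorem transpose_opBasis {n l : ℕ} (hl : l ≤ n) (m : ℤ) :
    (opBasis n l m)ᵀ = (-1 : ℂ) ^ m • opBasis n l (-m) := by
  by_cases h : |m| ≤ (l : ℤ)
  · obtain ⟨i, rfl⟩ := exists_index h
    have h1 := transpose_opBasisAux hl (show 2 * l - (i : ℕ) ≤ 2 * l by omega)
    rw [show 2 * l - (2 * l - (i : ℕ)) = i by omega] at h1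
    rw [opBasis_sub n (by omega), h1,
      show -((l : ℤ) - (i : ℕ)) = (l : ℤ) - ((2 * l - (i : ℕ) : ℕ) : ℤ) by omega,
      opBasis_sub n (by omega), ← zpow_natCast]
    congr 1
    refine neg_one_zpow_congr ?_
    omega
  · rw [opBasis_of_lt n h, opBasis_of_lt n (by rwa [abs_neg])]
    simp

theorem conjTranspose_opBasis (n l : ℕ) (m : ℤ) : (opBasis n l m)ᴴ = (opBasis n l m)ᵀ := by
  rw [opBasis]
  split_ifs
  · exact conjTranspose_opBasisAux n l _
  · simp

theorem dual_conj_opBasis (n l : ℕ) (m : ℤ) :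
    dual n * (opBasis n l m)ᵀ * (dual n)ᵀ = (-1 : ℂ) ^ l • opBasis n l m := by
  rw [opBasis]
  split_ifs
  · exact dual_conj_opBasisAux n l _
  · simp

theorem commutator_jThree_opBasis (n l : ℕ) (m : ℤ) :
    jThree n * opBasis n l m - opBasis n l m * jThree n = (m : ℂ) • opBasis n l m := by
  by_cases h : |m| ≤ (l : ℤ)
  · obtain ⟨i, rfl⟩ := exists_index h
    have h1 := commutator_gen_opBasisAux n l 2 i
    rw [sum_gen_two_smul, gen_two] at h1
    rw [opBasis_sub n (by omega), h1]
    congr 1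
    push_cast
    ring
  · simp [opBasis_of_lt n h]

/-! ### Symmetries of the trace of a product of three basis operators -/

theorem trace_opBasis_eq_zero (n l₁ l₂ l₃ : ℕ) {m₁ m₂ m₃ : ℤ} (h : m₁ + m₂ + m₃ ≠ 0) :
    (opBasis n l₁ m₁ * opBasis n l₂ m₂ * opBasis n l₃ m₃).trace = 0 := by
  set X := opBasis n l₁ m₁ with hX
  set Y := opBasis n l₂ m₂ with hY
  set Z := opBasis n l₃ m₃ with hZ
  -- The commutator with `J₃` has trace zero, while the Leibniz rule makes it `m₁ + m₂ + m₃` times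
  -- the product.
  have h1 : jThree n * (X * Y * Z) - X * Y * Z * jThree n =
      (jThree n * X - X * jThree n) * Y * Z + X * (jThree n * Y - Y * jThree n) * Z +
        X * Y * (jThree n * Z - Z * jThree n) := by
    noncomm_ring
  rw [hX, hY, hZ, commutator_jThree_opBasis, commutator_jThree_opBasis,
    commutator_jThree_opBasis, ← hX, ← hY, ← hZ] at h1
  have h2 := congrArg trace h1
  rw [trace_sub, trace_mul_comm, sub_self] at h2
  simp only [Matrix.smul_mul, Matrix.mul_smul, trace_add, trace_smul, smul_eq_mul] at h2
  have h3 : ((m₁ + m₂ + m₃ : ℤ) : ℂ) ≠ 0 := by exact_mod_cast h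
  push_cast at h3
  have h4 : ((m₁ : ℂ) + m₂ + m₃) * (X * Y * Z).trace = 0 := by linear_combination -h2
  exact (mul_eq_zero.mp h4).resolve_left h3

/-- The adjoint of `e^j(l₃,-m₃)` is `(-1)^{m₃} e^j(l₃,m₃)`. This absorbs the sign in the definition
of the symbol, and all three columns then play the same role. -/
theorem wignerProd_eq_trace {n l₃ : ℕ} (l₁ l₂ : ℕ) (hl : l₃ ≤ n) (m₁ m₂ m₃ : ℤ) :
    wignerProd n l₁ l₂ l₃ m₁ m₂ m₃ =
      (-1) ^ n * (opBasis n l₁ m₁ * opBasis n l₂ m₂ * opBasis n l₃ m₃).trace := by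
  rw [wignerProd, prodCoeff, hs, conjTranspose_opBasis, transpose_opBasis hl, neg_neg,
    Matrix.smul_mul, trace_smul, trace_mul_comm, smul_eq_mul, ← mul_assoc,
    ← zpow_add₀ (by simp), ← zpow_natCast]
  congr 1
  refine neg_one_zpow_congr ?_
  omega

theorem trace_opBasis_reverse (n l₁ l₂ l₃ : ℕ) (m₁ m₂ m₃ : ℤ) :
    (opBasis n l₁ m₁ * opBasis n l₂ m₂ * opBasis n l₃ m₃).trace =
      (-1) ^ (l₁ + l₂ + l₃) *
        (opBasis n l₃ m₃ * opBasis n l₂ m₂ * opBasis n l₁ m₁).trace := by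
  have h : ∀ X Y Z : Matrix (Fin (n + 1)) (Fin (n + 1)) ℂ, (X * Y * Z).trace =
      ((dual n * Zᵀ * (dual n)ᵀ) * (dual n * Yᵀ * (dual n)ᵀ) *
        (dual n * Xᵀ * (dual n)ᵀ)).trace := fun X Y Z => by
    have h1 : (dual n * Zᵀ * (dual n)ᵀ) * (dual n * Yᵀ * (dual n)ᵀ) *
        (dual n * Xᵀ * (dual n)ᵀ) = dual n * (X * Y * Z)ᵀ * (dual n)ᵀ := by
      calc _ = dual n * Zᵀ * ((dual n)ᵀ * dual n) * Yᵀ * ((dual n)ᵀ * dual n) * Xᵀ *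
            (dual n)ᵀ := by simp only [Matrix.mul_assoc]
        _ = _ := by
          rw [dual_transpose_mul_dual]
          simp only [transpose_mul, Matrix.mul_assoc, Matrix.one_mul]
    rw [h1, trace_mul_comm (dual n * (X * Y * Z)ᵀ), ← Matrix.mul_assoc, dual_transpose_mul_dual, Matrix.one_mul,
      trace_transpose]
  rw [h, dual_conj_opBasis, dual_conj_opBasis, dual_conj_opBasis]
  simp only [Matrix.smul_mul, Matrix.mul_smul, trace_smul, smul_eq_mul]
  ring

theorem trace_opBasis_cycle (n l₁ l₂ l₃ : ℕ) (m₁ m₂ m₃ : ℤ) :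
    (opBasis n l₁ m₁ * opBasis n l₂ m₂ * opBasis n l₃ m₃).trace =
      (opBasis n l₂ m₂ * opBasis n l₃ m₃ * opBasis n l₁ m₁).trace := by
  rw [Matrix.mul_assoc, trace_mul_comm]

theorem trace_opBasis_swap (n l₁ l₂ l₃ : ℕ) (m₁ m₂ m₃ : ℤ) :
    (opBasis n l₁ m₁ * opBasis n l₂ m₂ * opBasis n l₃ m₃).trace =
      (-1) ^ (l₁ + l₂ + l₃) *
        (opBasis n l₂ m₂ * opBasis n l₁ m₁ * opBasis n l₃ m₃).trace := by
  rw [trace_opBasis_reverse, trace_opBasis_cycle]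

theorem trace_opBasis_neg {n l₁ l₂ l₃ : ℕ} (h₁ : l₁ ≤ n) (h₂ : l₂ ≤ n) (h₃ : l₃ ≤ n)
    (m₁ m₂ m₃ : ℤ) :
    (opBasis n l₁ m₁ * opBasis n l₂ m₂ * opBasis n l₃ m₃).trace =
      (-1) ^ (l₁ + l₂ + l₃) *
        (opBasis n l₁ (-m₁) * opBasis n l₂ (-m₂) * opBasis n l₃ (-m₃)).trace := by
  -- Transposition contributes `(-1)^(m₁+m₂+m₃)`, which is `1` in this case; otherwise both traces
  -- vanish.
  by_cases h : m₁ + m₂ + m₃ = 0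
  · rw [trace_opBasis_reverse n l₁ l₂ l₃ (-m₁) (-m₂) (-m₃), ← mul_assoc, ← pow_add, ← two_mul,
      pow_mul, neg_one_sq, one_pow, one_mul, ← trace_transpose, transpose_mul, transpose_mul,
      transpose_opBasis h₁, transpose_opBasis h₂, transpose_opBasis h₃]
    simp only [Matrix.smul_mul, Matrix.mul_smul, trace_smul, smul_eq_mul, ← mul_assoc]
    rw [← zpow_add₀ (by simp), ← zpow_add₀ (by simp), h, zpow_zero, one_mul]
  · rw [trace_opBasis_eq_zero n l₁ l₂ l₃ h, trace_opBasis_eq_zero n l₁ l₂ l₃ (by omega), mul_zero]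

/-! ### Product coefficients and Clebsch-Gordan coefficients -/

theorem hs_commutator {n : ℕ} (A X Y : Matrix (Fin n) (Fin n) ℂ) :
    hs X (A * Y - Y * A) = hs (Aᴴ * X - X * Aᴴ) Y := by
  rw [hs, hs, conjTranspose_sub, conjTranspose_mul, conjTranspose_mul,
    conjTranspose_conjTranspose, Matrix.mul_sub, Matrix.sub_mul, trace_sub, trace_sub,
    Matrix.mul_assoc, ← Matrix.mul_assoc Xᴴ Y A, trace_mul_comm (Xᴴ * Y), Matrix.mul_assoc]

/-- The product coefficients of two tensor operators as a vector in the tensor product. -/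
noncomputable def productVector (n l₁ l₂ l k : ℕ) :
    Matrix (Fin (2 * l₁ + 1)) (Fin (2 * l₂ + 1)) ℂ :=
  Matrix.of fun p q => hs (opBasisAux n l k) (opBasisAux n l₁ p * opBasisAux n l₂ q)

/-- The commutator is a derivation of the product and, up to transposing the generator, self-adjoint
for the Hilbert-Schmidt form; so acting on both factors equals acting on `e^j(l, ·)`. -/
theorem isMultiplet_productVector (n l₁ l₂ l : ℕ) :
    IsMultiplet (2 * l₁) (2 * l₂) (2 * l) (productVector n l₁ l₂ l) := by
  intro s k
  ext p q
  have h1 : ∑ p' : Fin (2 * l₁ + 1), gen (2 * l₁) s p p' • opBasisAux n l₁ p' =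
      gen n (genSwap s) * opBasisAux n l₁ p - opBasisAux n l₁ p * gen n (genSwap s) := by
    rw [commutator_gen_opBasisAux]
    simp only [gen_swap_apply]
  have h2 : ∑ q' : Fin (2 * l₂ + 1), gen (2 * l₂) s q q' • opBasisAux n l₂ q' =
      gen n (genSwap s) * opBasisAux n l₂ q - opBasisAux n l₂ q * gen n (genSwap s) := by
    rw [commutator_gen_opBasisAux]
    simp only [gen_swap_apply]
  have h3 : hs (opBasisAux n l k)
      ((∑ p' : Fin (2 * l₁ + 1), gen (2 * l₁) s p p' • opBasisAux n l₁ p') * opBasisAux n l₂ q +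
        opBasisAux n l₁ p *
          ∑ q' : Fin (2 * l₂ + 1), gen (2 * l₂) s q q' • opBasisAux n l₂ q') =
      hs (∑ k' : Fin (2 * l + 1), gen (2 * l) s k' k • opBasisAux n l k')
        (opBasisAux n l₁ p * opBasisAux n l₂ q) := by
    have hg : gen n s = (gen n (genSwap s))ᴴ := by
      rw [gen_conjTranspose]
      congr 1
      fin_cases s <;> rfl
    rw [h1, h2, ← commutator_gen_opBasisAux, hg, ← hs_commutator]
    congr 1
    noncomm_ring
  rw [Finset.sum_mul, Finset.mul_sum, hs_add_right, hs_sum_right, hs_sum_right, hs_sum_left] at h3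
  simp only [Matrix.smul_mul, Matrix.mul_smul, hs_smul_right, hs_smul_left, star_gen_apply] at h3
  rw [act_apply, Matrix.sum_apply]
  simpa only [Matrix.smul_apply, smul_eq_mul, productVector, of_apply] using h3

theorem star_productVector (n l₁ l₂ l k : ℕ) (p : Fin (2 * l₁ + 1)) (q : Fin (2 * l₂ + 1)) :
    star (productVector n l₁ l₂ l k p q) = productVector n l₁ l₂ l k p q := by
  simp only [productVector, of_apply, hs_eq_sum, mul_apply, star_sum, star_mul',
    star_opBasisAux_apply]

theorem productVector_eq (n l₁ l₂ l : ℕ) :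
    ∃ R : ℂ, (∀ k ≤ 2 * l, ∀ p q, productVector n l₁ l₂ l k p q =
      R * star (coupledAux (2 * l₁) (2 * l₂) (2 * l) k p q)) ∧
      R * hs (coupledTop (2 * l₁) (2 * l₂) (2 * l)) (coupledTop (2 * l₁) (2 * l₂) (2 * l)) = R := by
  obtain ⟨R, h1, h2⟩ := (isMultiplet_productVector n l₁ l₂ l).exists_smul
  refine ⟨star R, fun k hk p q => ?_, ?_⟩
  · rw [← star_productVector, h1 k hk, Matrix.smul_apply, smul_eq_mul, star_mul']
  · conv_rhs => rw [← h2]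
    rw [star_mul', star_hs]

/-- The weight `l` of the top vector exceeds the largest weight `l₁ + l₂` of the tensor product. -/
theorem productVector_eq_zero (n : ℕ) {l₁ l₂ l : ℕ} (h : l₁ + l₂ < l) {k : ℕ} (hk : k ≤ 2 * l) :
    productVector n l₁ l₂ l k = 0 := by
  have hw := isMultiplet_productVector n l₁ l₂ l
  have h0 : productVector n l₁ l₂ l 0 = 0 := by
    ext p q
    refine apply_eq_zero_of_weight (x := (2 * l : ℕ)) ?_ ?_
    · simpa using hw.isTop.1
    · simp only [mag]
      push_cast
      omega
  rw [hw.eq_ladder hk, h0, ← zero_smul ℂ (0 : Matrix _ _ ℂ), ladder_smul, zero_smul, zero_smul]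

theorem prodCoeff_sub (n : ℕ) {l₁ l₂ l : ℕ} (p : Fin (2 * l₁ + 1)) (q : Fin (2 * l₂ + 1))
    (k : Fin (2 * l + 1)) :
    prodCoeff n l₁ l₂ l ((l₁ : ℤ) - (p : ℕ)) ((l₂ : ℤ) - (q : ℕ)) ((l : ℤ) - (k : ℕ)) =
      productVector n l₁ l₂ l k p q := by
  rw [prodCoeff, opBasis_sub n (by omega), opBasis_sub n (by omega), opBasis_sub n (by omega)]
  rfl

theorem trace_opBasis_eq_zero_of_lt {n l₃ : ℕ} (l₁ l₂ : ℕ) (hl : l₃ ≤ n) (h : l₁ + l₂ < l₃)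
    (m₁ m₂ m₃ : ℤ) : (opBasis n l₁ m₁ * opBasis n l₂ m₂ * opBasis n l₃ m₃).trace = 0 := by
  by_cases h₁ : |m₁| ≤ (l₁ : ℤ)
  swap
  · simp [opBasis_of_lt n h₁]
  by_cases h₂ : |m₂| ≤ (l₂ : ℤ)
  swap
  · simp [opBasis_of_lt n h₂]
  by_cases h₃ : |-m₃| ≤ (l₃ : ℤ)
  swap
  · rw [abs_neg] at h₃
    simp [opBasis_of_lt n h₃]
  have h4 := wignerProd_eq_trace l₁ l₂ hl m₁ m₂ m₃
  obtain ⟨k, hk⟩ := exists_index h₃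
  obtain ⟨p, rfl⟩ := exists_index h₁
  obtain ⟨q, rfl⟩ := exists_index h₂
  rw [wignerProd, hk, prodCoeff_sub, productVector_eq_zero n h (by omega), Matrix.zero_apply,
    mul_zero] at h4
  exact (mul_eq_zero.mp h4.symm).resolve_left (by simp)

theorem wignerProd_ne_zero {n l₁ l₂ l₃ : ℕ} (h₁ : l₁ ≤ n) (h₂ : l₂ ≤ n) (h₃ : l₃ ≤ n)
    {m₁ m₂ m₃ : ℤ} (h : wignerProd n l₁ l₂ l₃ m₁ m₂ m₃ ≠ 0) :
    m₁ + m₂ + m₃ = 0 ∧ Triangle l₁ l₂ l₃ := by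
  rw [wignerProd_eq_trace l₁ l₂ h₃] at h
  have h := right_ne_zero_of_mul h
  refine ⟨?_, ?_⟩
  · by_contra h0
    exact h (trace_opBasis_eq_zero n l₁ l₂ l₃ h0)
  -- Only one of the triangle inequalities comes from weights; cyclicity of the trace gives the
  -- other two.
  · have a1 : ¬ l₁ + l₂ < l₃ := fun h' => h (trace_opBasis_eq_zero_of_lt _ _ h₃ h' _ _ _)
    have a2 : ¬ l₂ + l₃ < l₁ := fun h' => h (by
      rw [trace_opBasis_cycle, trace_opBasis_eq_zero_of_lt _ _ h₁ h'])
    have a3 : ¬ l₃ + l₁ < l₂ := fun h' => h (by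
      rw [trace_opBasis_cycle, trace_opBasis_cycle, trace_opBasis_eq_zero_of_lt _ _ h₂ h'])
    rw [Triangle, abs_le]
    omega

/-! ### Clebsch-Gordan coefficients with one integral spin -/

theorem two_mul_index (l : ℕ) (i : Fin (2 * l + 1)) :
    2 * ((l : ℤ) - (i : ℕ)) = mag (2 * l) i := by
  rw [mag]
  push_cast
  ring

theorem neg_mag {n : ℕ} (k : Fin (n + 1)) : -mag n k = mag n k.rev := by
  rw [mag, mag, Fin.val_rev]
  omega

theorem clebschGordan_to_integral {n l : ℕ} (hl : l ≤ n) (k₁ k₂ : Fin (n + 1))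
    (i : Fin (2 * l + 1)) :
    clebschGordan n n (2 * l) (mag n k₁) (mag n k₂) (mag (2 * l) i) =
      (-1) ^ (k₂.rev : ℕ) * opBasisAux n l i k₁ k₂.rev := by
  rw [clebschGordan_mag, coupled_mag, coupledAux_eq_opBasisAux hl, mul_dual_transpose_apply,
    star_mul', star_opBasisAux_apply]
  simp

theorem clebschGordan_left {n l : ℕ} (hl : l ≤ n) (k q : Fin (n + 1)) (i : Fin (2 * l + 1)) :
    clebschGordan (2 * l) n n (mag (2 * l) i) (mag n q) (mag n k) =
      (-1) ^ l * (reduced n l : ℂ) * opBasisAux n l i k q := by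
  rw [clebschGordan_mag, coupled_mag, coupledAux_left hl, star_mul', star_mul',
    star_opBasisAux_apply]
  simp

theorem clebschGordan_right {n l : ℕ} (hl : l ≤ n) (k q : Fin (n + 1)) (i : Fin (2 * l + 1)) :
    clebschGordan n (2 * l) n (mag n q) (mag (2 * l) i) (mag n k) =
      (reduced n l : ℂ) * opBasisAux n l i k q := by
  rw [clebschGordan_mag, coupled_mag, coupledAux_right hl, star_mul', star_opBasisAux_apply]
  simp

theorem reduced_eq (n l : ℕ) : reduced n l = √((n : ℝ) + 1) / √(2 * (l : ℝ) + 1) :=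
  Real.sqrt_div (by positivity) _

/-- The factor `√(2l + 1)`. -/
noncomputable def dimRoot (l : ℕ) : ℂ := ((√(2 * (l : ℝ) + 1) : ℝ) : ℂ)

theorem dimRoot_ne_zero (l : ℕ) : dimRoot l ≠ 0 := by
  have : √(2 * (l : ℝ) + 1) ≠ 0 := (Real.sqrt_pos.mpr (by positivity)).ne'
  exact Complex.ofReal_ne_zero.mpr this

theorem dimRoot_mul_self (l : ℕ) : dimRoot l * dimRoot l = 2 * l + 1 := by
  rw [dimRoot, ← Complex.ofReal_mul, Real.mul_self_sqrt (by positivity)]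
  push_cast
  ring

theorem rootDim_eq (l₁ l₂ l₃ : ℕ) : rootDim l₁ l₂ l₃ = dimRoot l₁ * dimRoot l₂ * dimRoot l₃ := by
  rw [rootDim, Real.sqrt_mul (by positivity), Real.sqrt_mul (by positivity)]
  push_cast
  rfl

theorem sqrt_succ_ne_zero (n : ℕ) : ((√((n : ℝ) + 1) : ℝ) : ℂ) ≠ 0 := by
  have : √((n : ℝ) + 1) ≠ 0 := (Real.sqrt_pos.mpr (by positivity)).ne'
  exact_mod_cast this

theorem reduced_eq_div (n l : ℕ) :
    (reduced n l : ℂ) = ((√((n : ℝ) + 1) : ℝ) : ℂ) / dimRoot l := by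
  rw [reduced_eq]
  push_cast
  rfl

theorem threeJM_integral {n l : ℕ} (hl : l ≤ n) (k₁ k₂ : Fin (n + 1)) (i : Fin (2 * l + 1)) :
    threeJM n (2 * l) n (mag n k₁) (mag (2 * l) i) (-mag n k₂) =
      (-1) ^ (n + l + k₂) / dimRoot l * opBasisAux n l i k₂ k₁ := by
  have h1 : (-1 : ℂ) ^ (((n : ℤ) - (2 * l : ℕ) - -mag n k₂) / 2) = (-1) ^ (n + l + (k₂ : ℕ)) := by
    rw [← zpow_natCast]
    refine neg_one_zpow_congr ?_
    rw [mag]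
    push_cast
    omega
  have h2 := sqrt_succ_ne_zero n
  rw [threeJM, h1, neg_neg, clebschGordan_right hl, reduced_eq_div]
  field_simp

/-! ### Re-coupling coefficients -/

/-- The product rule inverted: the component along `e^j(l, ·)` is a multiple of the inner product of
the coupled vectors for `l` and `l₃`, so orthogonality leaves only the term `l₃`. -/
theorem sum_coupledAux_smul_mul {n l₃ : ℕ} (l₁ l₂ : ℕ) (h₃ : l₃ ≤ n) {R : ℂ}
    (hR : ∀ k ≤ 2 * l₃, ∀ p q, productVector n l₁ l₂ l₃ k p q =
      R * star (coupledAux (2 * l₁) (2 * l₂) (2 * l₃) k p q))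
    (hN : R * hs (coupledTop (2 * l₁) (2 * l₂) (2 * l₃)) (coupledTop (2 * l₁) (2 * l₂) (2 * l₃)) =
      R) (i : Fin (2 * l₃ + 1)) :
    ∑ p : Fin (2 * l₁ + 1), ∑ q : Fin (2 * l₂ + 1),
      coupledAux (2 * l₁) (2 * l₂) (2 * l₃) i p q • (opBasisAux n l₁ p * opBasisAux n l₂ q) =
        R • opBasisAux n l₃ i := by
  have h : ∀ l (k : Fin (2 * l + 1)), hs (opBasisAux n l k)
      (∑ p : Fin (2 * l₁ + 1), ∑ q : Fin (2 * l₂ + 1),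
        coupledAux (2 * l₁) (2 * l₂) (2 * l₃) i p q •
          (opBasisAux n l₁ p * opBasisAux n l₂ q)) =
      if l = l₃ ∧ (k : ℕ) = i then R else 0 := fun l k => by
    have h1 : ∀ R', (∀ k ≤ 2 * l, ∀ p q, productVector n l₁ l₂ l k p q =
        R' * star (coupledAux (2 * l₁) (2 * l₂) (2 * l) k p q)) → hs (opBasisAux n l k)
          (∑ p : Fin (2 * l₁ + 1), ∑ q : Fin (2 * l₂ + 1),
            coupledAux (2 * l₁) (2 * l₂) (2 * l₃) i p q •
              (opBasisAux n l₁ p * opBasisAux n l₂ q)) =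
        R' * hs (coupledAux (2 * l₁) (2 * l₂) (2 * l) k)
          (coupledAux (2 * l₁) (2 * l₂) (2 * l₃) i) := fun R' hR' => by
      rw [hs_eq_sum (coupledAux _ _ _ _), hs_sum_right, Finset.mul_sum]
      refine Finset.sum_congr rfl fun p _ => ?_
      rw [hs_sum_right, Finset.mul_sum]
      refine Finset.sum_congr rfl fun q _ => ?_
      have h2 := hR' k (by omega) p q
      rw [productVector, of_apply] at h2
      rw [hs_smul_right, h2]
      ring
    by_cases hl : l = l₃
    · subst hl
      rw [h1 R hR, hs_coupledAux (by omega) (by omega)]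
      simp only [true_and]
      split_ifs
      · exact hN
      · exact mul_zero _
    · obtain ⟨R', hR', -⟩ := productVector_eq n l₁ l₂ l
      rw [h1 R' hR', hs_coupledAux (by omega) (by omega), if_neg (by omega), if_neg (by omega),
        mul_zero]
  rw [eq_sum_opBasisAux (∑ p : Fin (2 * l₁ + 1), ∑ q : Fin (2 * l₂ + 1), _),
    Finset.sum_eq_single l₃, Finset.sum_eq_single i]
  · rw [h, if_pos ⟨rfl, rfl⟩]
  · intro k _ hk
    rw [h, if_neg (fun h' => hk (Fin.ext h'.2)), zero_smul]
  · simp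
  · intro l _ hl
    refine Finset.sum_eq_zero fun k _ => ?_
    rw [h, if_neg (fun h' => hl h'.1), zero_smul]
  · intro hl
    exact absurd (Finset.mem_range.mpr (by omega)) hl

theorem recoupling_eq {n l₁ l₂ l₃ : ℕ} (h₁ : l₁ ≤ n) (h₂ : l₂ ≤ n) (h₃ : l₃ ≤ n) {R : ℂ}
    (hR : ∀ k ≤ 2 * l₃, ∀ p q, productVector n l₁ l₂ l₃ k p q =
      R * star (coupledAux (2 * l₁) (2 * l₂) (2 * l₃) k p q))
    (hN : R * hs (coupledTop (2 * l₁) (2 * l₂) (2 * l₃)) (coupledTop (2 * l₁) (2 * l₂) (2 * l₃)) =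
      R) (k : Fin (n + 1)) :
    recoupling (2 * l₁) (2 * l₂) (2 * l₃) n n n (mag n k) =
      (-1) ^ (l₁ + l₂ + l₃) * ((√((n : ℝ) + 1) : ℝ) : ℂ) * dimRoot l₃ /
        (dimRoot l₁ * dimRoot l₂) * R := by
  have h12 : ∀ (p : Fin (2 * l₁ + 1)) (q : Fin (2 * l₂ + 1)) (r : Fin (n + 1)),
      star (couple12 (2 * l₁) (2 * l₂) n (2 * l₃) n (mag n k) (mag _ p) (mag _ q) (mag n r)) =
        ∑ i : Fin (2 * l₃ + 1), coupledAux (2 * l₁) (2 * l₂) (2 * l₃) i p q *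
          ((-1) ^ l₃ * (reduced n l₃ : ℂ) * opBasisAux n l₃ i k r) := fun p q r => by
    rw [couple12, ← sum_clebschGordan_mul _ _
      (fun z => clebschGordan (2 * l₃) n n z (mag n r) (mag n k)), star_sum]
    refine Finset.sum_congr rfl fun i _ => ?_
    rw [clebschGordan_left h₃, clebschGordan_mag, coupled_mag, star_mul', star_star, star_mul',
      star_mul', star_opBasisAux_apply]
    simp
  -- The sum over the intermediate magnetic number is a matrix multiplication.
  have h23 : ∀ (p : Fin (2 * l₁ + 1)) (q : Fin (2 * l₂ + 1)) (r : Fin (n + 1)),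
      couple23 (2 * l₁) (2 * l₂) n n n (mag n k) (mag _ p) (mag _ q) (mag n r) =
        (-1) ^ l₁ * (reduced n l₁ : ℂ) * ((-1) ^ l₂ * (reduced n l₂ : ℂ)) *
          (opBasisAux n l₁ p * opBasisAux n l₂ q) k r := fun p q r => by
    rw [couple23, ← sum_clebschGordan_mul _ _
      (fun z => clebschGordan (2 * l₁) n n (mag _ p) z (mag n k)), mul_apply, Finset.mul_sum]
    refine Finset.sum_congr rfl fun k' _ => ?_
    rw [clebschGordan_left h₁, clebschGordan_left h₂]
    ring
  -- After the sum over `p, q` collapses by `sum_coupledAux_smul_mul`, what is left is `R` times the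
  -- squared norm of row `k`, which does not depend on `k`.
  have hsum : ∑ p : Fin (2 * l₁ + 1), ∑ q : Fin (2 * l₂ + 1), ∑ r : Fin (n + 1),
      (∑ i : Fin (2 * l₃ + 1), coupledAux (2 * l₁) (2 * l₂) (2 * l₃) i p q *
        opBasisAux n l₃ i k r) * (opBasisAux n l₁ p * opBasisAux n l₂ q) k r =
      R * (((2 * l₃ + 1) / (n + 1) : ℝ) : ℂ) := by
    rw [← hs_rowVector h₃ k, hs_eq_sum, Finset.mul_sum]
    have h1 : ∀ i : Fin (2 * l₃ + 1), R * ∑ r, star (rowVector n l₃ k i r) *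
        rowVector n l₃ k i r = ∑ p : Fin (2 * l₁ + 1), ∑ q : Fin (2 * l₂ + 1),
          ∑ r : Fin (n + 1), coupledAux (2 * l₁) (2 * l₂) (2 * l₃) i p q *
        opBasisAux n l₃ i k r * (opBasisAux n l₁ p * opBasisAux n l₂ q) k r := fun i => by
      have h2 : ∀ r, R * opBasisAux n l₃ i k r = ∑ p : Fin (2 * l₁ + 1),
          ∑ q : Fin (2 * l₂ + 1), coupledAux (2 * l₁) (2 * l₂) (2 * l₃) i p q *
            (opBasisAux n l₁ p * opBasisAux n l₂ q) k r := fun r => by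
        have h3 := congrFun (congrFun (sum_coupledAux_smul_mul l₁ l₂ h₃ hR hN i) k) r
        simp only [Matrix.sum_apply, Matrix.smul_apply, smul_eq_mul] at h3
        exact h3.symm
      rw [Finset.mul_sum]
      simp only [rowVector_apply, star_opBasisAux_apply]
      rw [Finset.sum_congr rfl fun r _ => show R * (opBasisAux n l₃ i k r * opBasisAux n l₃ i k r) =
        ∑ p : Fin (2 * l₁ + 1), ∑ q : Fin (2 * l₂ + 1),
          coupledAux (2 * l₁) (2 * l₂) (2 * l₃) i p q *
            opBasisAux n l₃ i k r * (opBasisAux n l₁ p * opBasisAux n l₂ q) k r by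
          rw [← mul_assoc, h2, Finset.sum_mul]
          refine Finset.sum_congr rfl fun p _ => ?_
          rw [Finset.sum_mul]
          exact Finset.sum_congr rfl fun q _ => by ring]
      rw [Finset.sum_comm]
      exact Finset.sum_congr rfl fun p _ => Finset.sum_comm
    refine ((Finset.sum_congr rfl fun i _ => h1 i).trans ?_).symm
    rw [Finset.sum_comm]
    refine Finset.sum_congr rfl fun p _ => ?_
    rw [Finset.sum_comm]
    refine Finset.sum_congr rfl fun q _ => ?_
    rw [Finset.sum_comm]
    refine Finset.sum_congr rfl fun r _ => ?_
    rw [Finset.sum_mul]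
  have hfactor : recoupling (2 * l₁) (2 * l₂) (2 * l₃) n n n (mag n k) =
      ((-1) ^ l₁ * (reduced n l₁ : ℂ) * ((-1) ^ l₂ * (reduced n l₂ : ℂ)) *
        ((-1) ^ l₃ * (reduced n l₃ : ℂ))) * (R * (((2 * l₃ + 1) / (n + 1) : ℝ) : ℂ)) := by
    rw [← hsum, recoupling, Finset.mul_sum]
    refine Finset.sum_congr rfl fun p _ => ?_
    rw [Finset.mul_sum]
    refine Finset.sum_congr rfl fun q _ => ?_
    rw [Finset.mul_sum]
    refine Finset.sum_congr rfl fun r _ => ?_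
    rw [← Complex.star_def, h12, h23, Finset.sum_mul, Finset.sum_mul, Finset.mul_sum]
    exact Finset.sum_congr rfl fun i _ => by ring
  have e1 : ((√((n : ℝ) + 1) : ℝ) : ℂ) * ((√((n : ℝ) + 1) : ℝ) : ℂ) = n + 1 := by
    rw [← Complex.ofReal_mul, Real.mul_self_sqrt (by positivity)]
    push_cast
    rfl
  have e2 := sqrt_succ_ne_zero n
  have e3 := dimRoot_ne_zero l₁
  have e4 := dimRoot_ne_zero l₂
  have e5 := dimRoot_ne_zero l₃
  rw [hfactor, reduced_eq_div, reduced_eq_div, reduced_eq_div]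
  push_cast
  rw [← e1, ← dimRoot_mul_self, pow_add, pow_add]
  field_simp

theorem sqrt_dim_mul (n l : ℕ) : ((√((2 * (l : ℝ) + 1) * ((n : ℝ) + 1)) : ℝ) : ℂ) =
    dimRoot l * ((√((n : ℝ) + 1) : ℝ) : ℂ) := by
  rw [Real.sqrt_mul (by positivity)]
  push_cast
  rfl

theorem sixJ_eq_recoupling (n l₁ l₂ l₃ : ℕ) :
    sixJ (2 * l₁) (2 * l₂) (2 * l₃) n n n =
      (-1) ^ (l₁ + l₂ + n) / (dimRoot l₃ * ((√((n : ℝ) + 1) : ℝ) : ℂ)) *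
        recoupling (2 * l₁) (2 * l₂) (2 * l₃) n n n n := by
  rw [sixJ, ← sqrt_dim_mul, show (2 * l₁ + 2 * l₂ + n + n) / 2 = l₁ + l₂ + n by omega]
  push_cast
  rfl

theorem mag_zero (n : ℕ) : mag n 0 = n := by simp [mag]

/-- One and the same `R` is the ratio of product coefficients to Clebsch-Gordan coefficients and, up
to explicit factors, the re-coupling coefficient and the `6j` symbol. Eliminating it proves the
factorization. -/
theorem exists_prodCoeff_sixJ {n l₁ l₂ l₃ : ℕ} (h₁ : l₁ ≤ n) (h₂ : l₂ ≤ n) (h₃ : l₃ ≤ n) :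
    ∃ R : ℂ, (∀ m₁ m₂ m₃ : ℤ, |m₁| ≤ (l₁ : ℤ) → |m₂| ≤ (l₂ : ℤ) → |m₃| ≤ (l₃ : ℤ) →
        prodCoeff n l₁ l₂ l₃ m₁ m₂ m₃ =
          R * clebschGordan (2 * l₁) (2 * l₂) (2 * l₃) (2 * m₁) (2 * m₂) (2 * m₃)) ∧
      (∀ k : Fin (n + 1), recoupling (2 * l₁) (2 * l₂) (2 * l₃) n n n (mag n k) =
        (-1) ^ (l₁ + l₂ + l₃) * ((√((n : ℝ) + 1) : ℝ) : ℂ) * dimRoot l₃ /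
          (dimRoot l₁ * dimRoot l₂) * R) ∧
      sixJ (2 * l₁) (2 * l₂) (2 * l₃) n n n = (-1) ^ (l₃ + n) / (dimRoot l₁ * dimRoot l₂) * R := by
  obtain ⟨R, hR, hN⟩ := productVector_eq n l₁ l₂ l₃
  refine ⟨R, fun m₁ m₂ m₃ hm₁ hm₂ hm₃ => ?_, recoupling_eq h₁ h₂ h₃ hR hN, ?_⟩
  · obtain ⟨p, rfl⟩ := exists_index hm₁
    obtain ⟨q, rfl⟩ := exists_index hm₂
    obtain ⟨k, rfl⟩ := exists_index hm₃
    rw [prodCoeff_sub, hR k (by omega), two_mul_index, two_mul_index, two_mul_index,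
      clebschGordan_mag, coupled_mag]
  · have e2 := sqrt_succ_ne_zero n
    have e3 := dimRoot_ne_zero l₁
    have e4 := dimRoot_ne_zero l₂
    have e5 := dimRoot_ne_zero l₃
    have e6 : (-1 : ℂ) ^ (l₁ + l₂ + n) * (-1) ^ (l₁ + l₂ + l₃) = (-1) ^ (l₃ + n) := by
      rw [← pow_add, show l₁ + l₂ + n + (l₁ + l₂ + l₃) = 2 * (l₁ + l₂) + (l₃ + n) by ring, pow_add,
        pow_mul]
      simp
    rw [sixJ_eq_recoupling, ← mag_zero, recoupling_eq h₁ h₂ h₃ hR hN, ← e6]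
    field_simp

/-! ### Product rules and the parity property -/

theorem prodCoeff_eq_wignerProd (n l₁ l₂ l : ℕ) (m₁ m₂ m : ℤ) :
    prodCoeff n l₁ l₂ l m₁ m₂ m = (-1) ^ ((n : ℤ) + m) * wignerProd n l₁ l₂ l m₁ m₂ (-m) := by
  rw [wignerProd, neg_neg, ← mul_assoc, ← zpow_add₀ (by simp),
    neg_one_zpow_congr (x := n + m + (n - -m)) (y := 0) (by omega), zpow_zero, one_mul]

theorem prodCoeff_eq_zero {n l : ℕ} (l₁ l₂ : ℕ) (hl : l ≤ n) {m₁ m₂ m : ℤ} (h : m ≠ m₁ + m₂) :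
    prodCoeff n l₁ l₂ l m₁ m₂ m = 0 := by
  rw [prodCoeff_eq_wignerProd, wignerProd_eq_trace l₁ l₂ hl,
    trace_opBasis_eq_zero n l₁ l₂ l (by omega), mul_zero, mul_zero]

theorem wignerProd_swap {n l₃ : ℕ} (l₁ l₂ : ℕ) (h₃ : l₃ ≤ n) (m₁ m₂ m₃ : ℤ) :
    wignerProd n l₁ l₂ l₃ m₁ m₂ m₃ =
      (-1) ^ (l₁ + l₂ + l₃) * wignerProd n l₂ l₁ l₃ m₂ m₁ m₃ := by
  rw [wignerProd_eq_trace _ _ h₃, wignerProd_eq_trace _ _ h₃, trace_opBasis_swap]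
  ring

theorem wignerProd_neg {n l₁ l₂ l₃ : ℕ} (h₁ : l₁ ≤ n) (h₂ : l₂ ≤ n) (h₃ : l₃ ≤ n)
    (m₁ m₂ m₃ : ℤ) :
    wignerProd n l₁ l₂ l₃ m₁ m₂ m₃ =
      (-1) ^ (l₁ + l₂ + l₃) * wignerProd n l₁ l₂ l₃ (-m₁) (-m₂) (-m₃) := by
  rw [wignerProd_eq_trace _ _ h₃, wignerProd_eq_trace _ _ h₃, trace_opBasis_neg h₁ h₂ h₃]
  ring

theorem opBasis_mul_opBasis (n l₁ l₂ : ℕ) (m₁ m₂ : ℤ) :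
    opBasis n l₁ m₁ * opBasis n l₂ m₂ =
      ∑ l ∈ Finset.range (n + 1),
        prodCoeff n l₁ l₂ l m₁ m₂ (m₁ + m₂) • opBasis n l (m₁ + m₂) := by
  conv_lhs => rw [eq_sum_opBasisAux (opBasis n l₁ m₁ * opBasis n l₂ m₂)]
  refine Finset.sum_congr rfl fun l hl => ?_
  have hl : l ≤ n := by simpa [Nat.lt_succ_iff] using hl
  have h : ∀ i : Fin (2 * l + 1), hs (opBasisAux n l i) (opBasis n l₁ m₁ * opBasis n l₂ m₂) •
      opBasisAux n l i = prodCoeff n l₁ l₂ l m₁ m₂ ((l : ℤ) - (i : ℕ)) •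
        opBasis n l ((l : ℤ) - (i : ℕ)) := fun i => by
    rw [prodCoeff, opBasis_sub n (by omega)]
  simp only [h]
  by_cases hm : |m₁ + m₂| ≤ (l : ℤ)
  · obtain ⟨k, hk⟩ := exists_index hm
    rw [Finset.sum_eq_single k, hk]
    · intro i _ hi
      rw [prodCoeff_eq_zero l₁ l₂ hl, zero_smul]
      intro h'
      exact hi (Fin.ext (by omega))
    · simp
  · rw [opBasis_of_lt n hm, smul_zero]
    refine Finset.sum_eq_zero fun i _ => ?_
    rw [prodCoeff_eq_zero l₁ l₂ hl, zero_smul]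
    intro h'
    rw [← h', abs_le] at hm
    omega

theorem opBasis_mul_opBasis_wignerProd (n l₁ l₂ : ℕ) (m₁ m₂ : ℤ) :
    opBasis n l₁ m₁ * opBasis n l₂ m₂ =
      ∑ l ∈ Finset.range (n + 1), ((-1 : ℂ) ^ ((n : ℤ) + (m₁ + m₂)) *
        wignerProd n l₁ l₂ l m₁ m₂ (-(m₁ + m₂))) • opBasis n l (m₁ + m₂) := by
  rw [opBasis_mul_opBasis]
  simp only [prodCoeff_eq_wignerProd]

/-! ### Expansions in Clebsch-Gordan coefficients and `3jm` symbols -/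

theorem prodCoeff_eq_sum_clebschGordan {n l₁ l₂ l : ℕ} (h₁ : l₁ ≤ n) (h₂ : l₂ ≤ n) (h : l ≤ n)
    {m₁ m₂ m : ℤ} (hm₁ : |m₁| ≤ (l₁ : ℤ)) (hm₂ : |m₂| ≤ (l₂ : ℤ)) (hm : |m| ≤ (l : ℤ)) :
    prodCoeff n l₁ l₂ l m₁ m₂ m =
      ∑ k₁ : Fin (n + 1), ∑ k₂ : Fin (n + 1), ∑ k₃ : Fin (n + 1),
        (-1 : ℂ) ^ (((n : ℤ) + mag n k₂) / 2) *
          clebschGordan n n (2 * l₁) (mag n k₁) (mag n k₂) (2 * m₁) *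
          clebschGordan n n (2 * l₂) (-mag n k₂) (mag n k₃) (2 * m₂) *
          clebschGordan n n (2 * l) (mag n k₁) (mag n k₃) (2 * m) := by
  obtain ⟨p, rfl⟩ := exists_index hm₁
  obtain ⟨q, rfl⟩ := exists_index hm₂
  obtain ⟨k, rfl⟩ := exists_index hm
  -- Reversing `k₂` and `k₃` turns the coefficients into matrix entries; the given sign cancels that
  -- of the first coefficient, and the signs of the other two cancel each other.
  have hterm : ∀ k₁ k₂ k₃ : Fin (n + 1), (-1 : ℂ) ^ (((n : ℤ) + mag n k₂) / 2) *
        clebschGordan n n (2 * l₁) (mag n k₁) (mag n k₂) (mag (2 * l₁) p) *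
        clebschGordan n n (2 * l₂) (-mag n k₂) (mag n k₃) (mag (2 * l₂) q) *
        clebschGordan n n (2 * l) (mag n k₁) (mag n k₃) (mag (2 * l) k) =
      opBasisAux n l k k₁ k₃.rev * (opBasisAux n l₁ p k₁ k₂.rev *
        opBasisAux n l₂ q k₂.rev k₃.rev) := fun k₁ k₂ k₃ => by
    have h1 : (-1 : ℂ) ^ (((n : ℤ) + mag n k₂) / 2) = (-1) ^ (k₂.rev : ℕ) := by
      rw [← zpow_natCast]
      congr 1
      rw [mag, Fin.val_rev]
      omega
    have h2 : ∀ i : ℕ, (-1 : ℂ) ^ i * (-1) ^ i = 1 := fun i => by simp [← mul_pow]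
    rw [h1, neg_mag, clebschGordan_to_integral h₁, clebschGordan_to_integral h₂,
      clebschGordan_to_integral h]
    calc _ = ((-1 : ℂ) ^ (k₂.rev : ℕ) * (-1) ^ (k₂.rev : ℕ)) *
          ((-1 : ℂ) ^ (k₃.rev : ℕ) * (-1) ^ (k₃.rev : ℕ)) *
          (opBasisAux n l k k₁ k₃.rev * (opBasisAux n l₁ p k₁ k₂.rev *
            opBasisAux n l₂ q k₂.rev k₃.rev)) := by ring
      _ = _ := by rw [h2, h2, one_mul, one_mul]
  simp only [two_mul_index, hterm]
  rw [prodCoeff_sub, productVector, of_apply, hs_eq_sum]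
  refine Finset.sum_congr rfl fun k₁ _ => ?_
  rw [Finset.sum_comm, ← Equiv.sum_comp Fin.revPerm]
  refine Finset.sum_congr rfl fun k₃ _ => ?_
  rw [star_opBasisAux_apply, mul_apply, ← Equiv.sum_comp Fin.revPerm, Finset.mul_sum]
  rfl

theorem wignerProd_eq_sum_threeJM {n l₁ l₂ l₃ : ℕ} (h₁ : l₁ ≤ n) (h₂ : l₂ ≤ n) (h₃ : l₃ ≤ n)
    {m₁ m₂ m₃ : ℤ} (hm₁ : |m₁| ≤ (l₁ : ℤ)) (hm₂ : |m₂| ≤ (l₂ : ℤ)) (hm₃ : |m₃| ≤ (l₃ : ℤ)) :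
    wignerProd n l₁ l₂ l₃ m₁ m₂ m₃ =
      rootDim l₁ l₂ l₃ *
        ∑ k₁ : Fin (n + 1), ∑ k₂ : Fin (n + 1), ∑ k₃ : Fin (n + 1),
          (-1 : ℂ) ^ ((3 * (n : ℤ) - mag n k₁ - mag n k₂ - mag n k₃) / 2) *
            threeJM n (2 * l₁) n (mag n k₁) (2 * m₁) (-mag n k₂) *
            threeJM n (2 * l₂) n (mag n k₂) (2 * m₂) (-mag n k₃) *
            threeJM n (2 * l₃) n (mag n k₃) (2 * m₃) (-mag n k₁) := by
  -- The `3jm` symbol with `μ₁, -μ₂` is an entry in row `μ₂` and column `μ₁`, so the chain of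
  -- symbols multiplies the operators in reverse order.
  rw [wignerProd_eq_trace l₁ l₂ h₃, trace_opBasis_reverse]
  obtain ⟨p, rfl⟩ := exists_index hm₁
  obtain ⟨q, rfl⟩ := exists_index hm₂
  obtain ⟨k, rfl⟩ := exists_index hm₃
  have e3 := dimRoot_ne_zero l₁
  have e4 := dimRoot_ne_zero l₂
  have e5 := dimRoot_ne_zero l₃
  have hterm : ∀ k₁ k₂ k₃ : Fin (n + 1),
      (-1 : ℂ) ^ ((3 * (n : ℤ) - mag n k₁ - mag n k₂ - mag n k₃) / 2) *
        threeJM n (2 * l₁) n (mag n k₁) (mag (2 * l₁) p) (-mag n k₂) *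
        threeJM n (2 * l₂) n (mag n k₂) (mag (2 * l₂) q) (-mag n k₃) *
        threeJM n (2 * l₃) n (mag n k₃) (mag (2 * l₃) k) (-mag n k₁) =
      (-1) ^ n * (-1) ^ (l₁ + l₂ + l₃) / (dimRoot l₁ * dimRoot l₂ * dimRoot l₃) *
        (opBasisAux n l₃ k k₁ k₃ * opBasisAux n l₂ q k₃ k₂ * opBasisAux n l₁ p k₂ k₁) :=
    fun k₁ k₂ k₃ => by
    have h1 : (-1 : ℂ) ^ ((3 * (n : ℤ) - mag n k₁ - mag n k₂ - mag n k₃) / 2) =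
        (-1) ^ ((k₁ : ℕ) + k₂ + k₃) := by
      rw [← zpow_natCast]
      congr 1
      simp only [mag]
      push_cast
      omega
    have h2 : (-1 : ℂ) ^ ((k₁ : ℕ) + k₂ + k₃) * (-1) ^ (n + l₁ + k₂) * (-1) ^ (n + l₂ + k₃) *
        (-1) ^ (n + l₃ + k₁) = (-1) ^ n * (-1) ^ (l₁ + l₂ + l₃) := by
      rw [← pow_add, ← pow_add, ← pow_add, ← pow_add, ← zpow_natCast, ← zpow_natCast]
      refine neg_one_zpow_congr ?_
      push_cast
      omega
    rw [h1, threeJM_integral h₁, threeJM_integral h₂, threeJM_integral h₃, ← h2]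
    field_simp
  simp only [two_mul_index, hterm, ← Finset.mul_sum]
  rw [opBasis_sub n (by omega), opBasis_sub n (by omega), opBasis_sub n (by omega), rootDim_eq,
    trace]
  have h : ∑ k₁ : Fin (n + 1), (opBasisAux n l₃ k * opBasisAux n l₂ q * opBasisAux n l₁ p).diag k₁ =
      ∑ k₁ : Fin (n + 1), ∑ k₂ : Fin (n + 1), ∑ k₃ : Fin (n + 1),
        opBasisAux n l₃ k k₁ k₃ * opBasisAux n l₂ q k₃ k₂ * opBasisAux n l₁ p k₂ k₁ := by
    simp only [diag_apply, mul_apply, Finset.sum_mul]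
  rw [h]
  field_simp

/-! ### Independence of the magnetic number and the `6j` factorization -/

theorem recoupling_mag_eq {n l₁ l₂ l₃ : ℕ} (h₁ : l₁ ≤ n) (h₂ : l₂ ≤ n) (h₃ : l₃ ≤ n)
    (k : Fin (n + 1)) :
    recoupling (2 * l₁) (2 * l₂) (2 * l₃) n n n (mag n k) =
      (-1 : ℂ) ^ (l₁ + l₂ + n) *
        ((√((2 * (l₃ : ℝ) + 1) * ((n : ℝ) + 1)) : ℝ) : ℂ) *
        sixJ (2 * l₁) (2 * l₂) (2 * l₃) n n n := by
  obtain ⟨R, -, h, -⟩ := exists_prodCoeff_sixJ h₁ h₂ h₃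
  have e2 := sqrt_succ_ne_zero n
  have e5 := dimRoot_ne_zero l₃
  have e6 : (-1 : ℂ) ^ (l₁ + l₂ + n) * (-1) ^ (l₁ + l₂ + n) = 1 := by simp [← mul_pow]
  have e7 : recoupling (2 * l₁) (2 * l₂) (2 * l₃) n n n n =
      recoupling (2 * l₁) (2 * l₂) (2 * l₃) n n n (mag n k) := by
    rw [← mag_zero, h, h]
  rw [sqrt_dim_mul, sixJ_eq_recoupling, e7]
  field_simp
  rw [pow_two, e6, mul_one]

theorem wignerProd_eq_threeJM_mul_sixJ {n l₁ l₂ l₃ : ℕ} (h₁ : l₁ ≤ n) (h₂ : l₂ ≤ n)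
    (h₃ : l₃ ≤ n) {m₁ m₂ m₃ : ℤ} (hm₁ : |m₁| ≤ (l₁ : ℤ)) (hm₂ : |m₂| ≤ (l₂ : ℤ))
    (hm₃ : |m₃| ≤ (l₃ : ℤ)) :
    wignerProd n l₁ l₂ l₃ m₁ m₂ m₃ =
      rootDim l₁ l₂ l₃ *
        threeJM (2 * l₁) (2 * l₂) (2 * l₃) (-(2 * m₁)) (-(2 * m₂)) (-(2 * m₃)) *
        sixJ (2 * l₁) (2 * l₂) (2 * l₃) n n n := by
  obtain ⟨R, hR, -, h6⟩ := exists_prodCoeff_sixJ h₁ h₂ h₃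
  have e3 := dimRoot_ne_zero l₁
  have e4 := dimRoot_ne_zero l₂
  have e5 := dimRoot_ne_zero l₃
  have e6 : ((√(((2 * l₃ : ℕ) : ℝ) + 1) : ℝ) : ℂ) = dimRoot l₃ := by
    rw [dimRoot]
    push_cast
    rfl
  have e7 : (-1 : ℂ) ^ (l₁ + l₂ + l₃) * (-1) ^ ((n : ℤ) - -m₃) =
      (-1) ^ ((((2 * l₁ : ℕ) : ℤ) - (2 * l₂ : ℕ) - -(2 * m₃)) / 2) * (-1) ^ (l₃ + n) := by
    rw [← zpow_natCast, ← zpow_natCast, ← zpow_add₀ (by simp), ← zpow_add₀ (by simp)]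
    refine neg_one_zpow_congr ?_
    push_cast
    omega
  -- All magnetic numbers are reversed first, to match the signs in the `3jm` symbol; the factor
  -- `(-1)^(l₁+l₂+l₃)` then enters the sign comparison `e7`.
  rw [wignerProd_neg h₁ h₂ h₃, wignerProd,
    hR _ _ _ (by rwa [abs_neg]) (by rwa [abs_neg]) (by rwa [neg_neg]), ← mul_assoc, e7, h6,
    rootDim_eq, threeJM, e6, neg_neg, neg_neg, mul_neg, mul_neg]
  field_simp

/-! ### The parity property -/

theorem commutator_opBasis (n l₁ l₂ : ℕ) (m₁ m₂ : ℤ) (h₁ : l₁ ≤ n) (h₂ : l₂ ≤ n) :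
    opBasis n l₁ m₁ * opBasis n l₂ m₂ - opBasis n l₂ m₂ * opBasis n l₁ m₁ =
        ∑ l ∈ (Finset.range (n + 1)).filter
            (fun l => Triangle l₁ l₂ l ∧ l ≡ l₁ + l₂ + 1 [MOD 2]),
          (2 * (-1 : ℂ) ^ ((n : ℤ) + (m₁ + m₂)) *
            wignerProd n l₁ l₂ l m₁ m₂ (-(m₁ + m₂))) • opBasis n l (m₁ + m₂) ∧
      opBasis n l₁ m₁ * opBasis n l₂ m₂ + opBasis n l₂ m₂ * opBasis n l₁ m₁ =
        ∑ l ∈ (Finset.range (n + 1)).filter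
            (fun l => Triangle l₁ l₂ l ∧ l ≡ l₁ + l₂ [MOD 2]),
          (2 * (-1 : ℂ) ^ ((n : ℤ) + (m₁ + m₂)) *
            wignerProd n l₁ l₂ l m₁ m₂ (-(m₁ + m₂))) • opBasis n l (m₁ + m₂) := by
  have hodd : ∀ l, l ≡ l₁ + l₂ + 1 [MOD 2] → (-1 : ℂ) ^ (l₂ + l₁ + l) = -1 := fun l h => by
    refine Odd.neg_one_pow ?_
    rw [Nat.odd_iff]
    rw [Nat.ModEq] at h
    omega
  have heven : ∀ l, l ≡ l₁ + l₂ [MOD 2] → (-1 : ℂ) ^ (l₂ + l₁ + l) = 1 := fun l h => by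
    refine Even.neg_one_pow ?_
    rw [Nat.even_iff]
    rw [Nat.ModEq] at h
    omega
  rw [opBasis_mul_opBasis_wignerProd n l₁ l₂, opBasis_mul_opBasis_wignerProd n l₂ l₁,
    add_comm m₂ m₁, ← Finset.sum_sub_distrib, ← Finset.sum_add_distrib, Finset.sum_filter,
    Finset.sum_filter]
  refine ⟨Finset.sum_congr rfl fun l hl => ?_, Finset.sum_congr rfl fun l hl => ?_⟩
  all_goals
    have hl : l ≤ n := by simpa [Nat.lt_succ_iff] using hl
    -- The coefficients of the two products differ by `(-1)^(l₁+l₂+l)`, so each term either cancels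
    -- or doubles.
    rw [wignerProd_swap l₂ l₁ hl m₂ m₁]
    by_cases hT : Triangle l₁ l₂ l
    swap
    · have h0 : wignerProd n l₁ l₂ l m₁ m₂ (-(m₁ + m₂)) = 0 := by
        by_contra h
        exact hT (wignerProd_ne_zero h₁ h₂ hl h).2
      simp only [h0, mul_zero, zero_smul, sub_zero, add_zero, ite_self]
    rcases Nat.mod_two_eq_zero_or_one (l₁ + l₂ + l) with hpar | hpar
  · rw [if_neg (fun h => by have := h.2; rw [Nat.ModEq] at this; omega),
      heven l (by rw [Nat.ModEq]; omega)]
    simp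
  · have h : l ≡ l₁ + l₂ + 1 [MOD 2] := by rw [Nat.ModEq]; omega
    rw [if_pos ⟨hT, h⟩, hodd l h]
    module
  · have h : l ≡ l₁ + l₂ [MOD 2] := by rw [Nat.ModEq]; omega
    rw [if_pos ⟨hT, h⟩, heven l h]
    module
  · rw [if_neg (fun h => by have := h.2; rw [Nat.ModEq] at this; omega),
      hodd l (by rw [Nat.ModEq]; omega)]
    simp

theorem exists_opUnnormAux_eq {n l k : ℕ} (hl : l ≤ n) (hk : k ≤ 2 * l) :
    ∃ c : ℂ, c ≠ 0 ∧ opUnnormAux n l k = c • opBasisAux n l k := by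
  induction k with
  | zero =>
    have h : ((opNorm n l : ℝ) : ℂ) ≠ 0 := by exact_mod_cast (opNorm_pos hl).1.ne'
    have h1 : (-1 : ℂ) ^ l / ((opNorm n l : ℝ) : ℂ) ≠ 0 := div_ne_zero (by simp) h
    refine ⟨_, inv_ne_zero h1, ?_⟩
    rw [opBasisAux_zero, smul_smul, inv_mul_cancel₀ h1, one_smul]
    rfl
  | succ k ih =>
    obtain ⟨c, hc, e⟩ := ih (by omega)
    have h := ladderCoeff_ne_zero (show k < 2 * l by omega)
    refine ⟨c * ladderCoeff (2 * l) k, mul_ne_zero hc h, ?_⟩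
    rw [opBasisAux_succ, smul_smul, mul_assoc, mul_one_div_cancel h, mul_one, opUnnormAux, e,
      Matrix.mul_smul, Matrix.smul_mul, smul_sub]

theorem exists_opUnnorm_eq (n : ℕ) :
    ∃ c : ℕ → ℤ → ℂ, ∀ l ≤ n, ∀ m, c l m ≠ 0 ∧ opUnnorm n l m = c l m • opBasis n l m := by
  have h : ∀ (l : ℕ) (m : ℤ), ∃ c : ℂ, l ≤ n → c ≠ 0 ∧ opUnnorm n l m = c • opBasis n l m :=
      fun l m => by
    by_cases hl : l ≤ n
    · by_cases hm : |m| ≤ (l : ℤ)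
      · have hk : ((l : ℤ) - m).toNat ≤ 2 * l := by
          rw [abs_le] at hm
          omega
        obtain ⟨c, hc, e⟩ := exists_opUnnormAux_eq hl hk
        exact ⟨c, fun _ => ⟨hc, by rw [opUnnorm, opBasis, if_pos hm, if_pos hm, e]⟩⟩
      -- For `|m| > l` both operators are zero; the factor `1` keeps later division by it
      -- legitimate.
      · exact ⟨1, fun _ => ⟨one_ne_zero, by rw [opUnnorm, opBasis, if_neg hm, if_neg hm, smul_zero]⟩⟩
    · exact ⟨0, fun h => absurd h hl⟩
  choose c hc using h
  exact ⟨c, fun l hl m => hc l m hl⟩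

theorem exists_commutator_opUnnorm (n : ℕ) :
    ∃ K : ℕ → ℕ → ℕ → ℤ → ℤ → ℂ,
      ∀ (l₁ l₂ : ℕ) (m₁ m₂ : ℤ), l₁ ≤ n → l₂ ≤ n → |m₁| ≤ (l₁ : ℤ) → |m₂| ≤ (l₂ : ℤ) →
        opUnnorm n l₁ m₁ * opUnnorm n l₂ m₂ - opUnnorm n l₂ m₂ * opUnnorm n l₁ m₁ =
          ∑ l ∈ (Finset.range (n + 1)).filter
              (fun l => Triangle l₁ l₂ l ∧ l ≡ l₁ + l₂ + 1 [MOD 2]),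
            K l₁ l₂ l m₁ m₂ • opUnnorm n l (m₁ + m₂) ∧
        opUnnorm n l₁ m₁ * opUnnorm n l₂ m₂ + opUnnorm n l₂ m₂ * opUnnorm n l₁ m₁ =
          ∑ l ∈ (Finset.range (n + 1)).filter
              (fun l => Triangle l₁ l₂ l ∧ l ≡ l₁ + l₂ [MOD 2]),
            K l₁ l₂ l m₁ m₂ • opUnnorm n l (m₁ + m₂) := by
  obtain ⟨c, hc⟩ := exists_opUnnorm_eq n
  -- The coefficient for the `e^j(l,m)`, rescaled. One `K` serves both sums, as they run over `l` of
  -- opposite parity.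
  refine ⟨fun l₁ l₂ l m₁ m₂ => c l₁ m₁ * c l₂ m₂ * (2 * (-1 : ℂ) ^ ((n : ℤ) + (m₁ + m₂)) *
    wignerProd n l₁ l₂ l m₁ m₂ (-(m₁ + m₂))) / c l (m₁ + m₂), fun l₁ l₂ m₁ m₂ h₁ h₂ _ _ => ?_⟩
  obtain ⟨hcomm, hanti⟩ := commutator_opBasis n l₁ l₂ m₁ m₂ h₁ h₂
  have hXY : opUnnorm n l₁ m₁ * opUnnorm n l₂ m₂ =
      (c l₁ m₁ * c l₂ m₂) • (opBasis n l₁ m₁ * opBasis n l₂ m₂) := by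
    rw [(hc l₁ h₁ m₁).2, (hc l₂ h₂ m₂).2, Matrix.smul_mul, Matrix.mul_smul, smul_smul]
  have hYX : opUnnorm n l₂ m₂ * opUnnorm n l₁ m₁ =
      (c l₁ m₁ * c l₂ m₂) • (opBasis n l₂ m₂ * opBasis n l₁ m₁) := by
    rw [(hc l₁ h₁ m₁).2, (hc l₂ h₂ m₂).2, Matrix.smul_mul, Matrix.mul_smul, smul_smul, mul_comm]
  rw [hXY, hYX, ← smul_sub, ← smul_add, hcomm, hanti, Finset.smul_sum, Finset.smul_sum]
  refine ⟨Finset.sum_congr rfl fun l hl => ?_, Finset.sum_congr rfl fun l hl => ?_⟩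
  all_goals
    have hl : l ≤ n := by
      have := (Finset.mem_filter.mp hl).1
      simpa [Nat.lt_succ_iff] using this
    rw [(hc l hl _).2, smul_smul, smul_smul, div_mul_cancel₀ _ (hc l hl _).1]

end SpinJ

/-- Spin `j = n / 2`. In order: the product rule with the product coefficients; their expression
by Clebsch-Gordan coefficients; the Wigner product symbol as a sum of products of three `3jm`
symbols; the independence of `m` of the re-coupling coefficient that defines the `6j` symbol;
the factorization of the Wigner product symbol; the product rule with `3jm` and `6j` symbols;
the symmetries and non-vanishing conditions of the Wigner product symbol; the parity property,
for the `e^j(l,m)` and for the `E(l,m)`. -/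
theorem theorem3p3p2 (n : ℕ) :
    (∀ (l₁ l₂ : ℕ) (m₁ m₂ : ℤ), l₁ ≤ n → l₂ ≤ n → |m₁| ≤ (l₁ : ℤ) → |m₂| ≤ (l₂ : ℤ) →
      opBasis n l₁ m₁ * opBasis n l₂ m₂ =
        ∑ l ∈ Finset.range (n + 1),
          prodCoeff n l₁ l₂ l m₁ m₂ (m₁ + m₂) • opBasis n l (m₁ + m₂)) ∧
    (∀ (l₁ l₂ l : ℕ) (m₁ m₂ m : ℤ), l₁ ≤ n → l₂ ≤ n → l ≤ n →
      |m₁| ≤ (l₁ : ℤ) → |m₂| ≤ (l₂ : ℤ) → |m| ≤ (l : ℤ) →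
      prodCoeff n l₁ l₂ l m₁ m₂ m =
        ∑ k₁ : Fin (n + 1), ∑ k₂ : Fin (n + 1), ∑ k₃ : Fin (n + 1),
          (-1 : ℂ) ^ (((n : ℤ) + mag n k₂) / 2) *
            clebschGordan n n (2 * l₁) (mag n k₁) (mag n k₂) (2 * m₁) *
            clebschGordan n n (2 * l₂) (-mag n k₂) (mag n k₃) (2 * m₂) *
            clebschGordan n n (2 * l) (mag n k₁) (mag n k₃) (2 * m)) ∧
    (∀ (l₁ l₂ l₃ : ℕ) (m₁ m₂ m₃ : ℤ), l₁ ≤ n → l₂ ≤ n → l₃ ≤ n →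
      |m₁| ≤ (l₁ : ℤ) → |m₂| ≤ (l₂ : ℤ) → |m₃| ≤ (l₃ : ℤ) →
      wignerProd n l₁ l₂ l₃ m₁ m₂ m₃ =
        rootDim l₁ l₂ l₃ *
          ∑ k₁ : Fin (n + 1), ∑ k₂ : Fin (n + 1), ∑ k₃ : Fin (n + 1),
            (-1 : ℂ) ^ ((3 * (n : ℤ) - mag n k₁ - mag n k₂ - mag n k₃) / 2) *
              threeJM n (2 * l₁) n (mag n k₁) (2 * m₁) (-mag n k₂) *
              threeJM n (2 * l₂) n (mag n k₂) (2 * m₂) (-mag n k₃) *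
              threeJM n (2 * l₃) n (mag n k₃) (2 * m₃) (-mag n k₁)) ∧
    (∀ (l₁ l₂ l₃ : ℕ) (k : Fin (n + 1)), l₁ ≤ n → l₂ ≤ n → l₃ ≤ n →
      recoupling (2 * l₁) (2 * l₂) (2 * l₃) n n n (mag n k) =
        (-1 : ℂ) ^ (l₁ + l₂ + n) *
          ((√((2 * (l₃ : ℝ) + 1) * ((n : ℝ) + 1)) : ℝ) : ℂ) *
          sixJ (2 * l₁) (2 * l₂) (2 * l₃) n n n) ∧
    (∀ (l₁ l₂ l₃ : ℕ) (m₁ m₂ m₃ : ℤ), l₁ ≤ n → l₂ ≤ n → l₃ ≤ n →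
      |m₁| ≤ (l₁ : ℤ) → |m₂| ≤ (l₂ : ℤ) → |m₃| ≤ (l₃ : ℤ) →
      wignerProd n l₁ l₂ l₃ m₁ m₂ m₃ =
        rootDim l₁ l₂ l₃ *
          threeJM (2 * l₁) (2 * l₂) (2 * l₃) (-(2 * m₁)) (-(2 * m₂)) (-(2 * m₃)) *
          sixJ (2 * l₁) (2 * l₂) (2 * l₃) n n n) ∧
    (∀ (l₁ l₂ : ℕ) (m₁ m₂ : ℤ), l₁ ≤ n → l₂ ≤ n → |m₁| ≤ (l₁ : ℤ) → |m₂| ≤ (l₂ : ℤ) →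
      opBasis n l₁ m₁ * opBasis n l₂ m₂ =
        ∑ l ∈ Finset.range (n + 1),
          ((-1 : ℂ) ^ ((n : ℤ) + (m₁ + m₂)) * rootDim l₁ l₂ l *
            threeJM (2 * l₁) (2 * l₂) (2 * l) (-(2 * m₁)) (-(2 * m₂)) (2 * (m₁ + m₂)) *
            sixJ (2 * l₁) (2 * l₂) (2 * l) n n n) • opBasis n l (m₁ + m₂)) ∧
    (∀ (l₁ l₂ l₃ : ℕ) (m₁ m₂ m₃ : ℤ), l₁ ≤ n → l₂ ≤ n → l₃ ≤ n →
      |m₁| ≤ (l₁ : ℤ) → |m₂| ≤ (l₂ : ℤ) → |m₃| ≤ (l₃ : ℤ) →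
      wignerProd n l₁ l₂ l₃ m₁ m₂ m₃ = wignerProd n l₂ l₃ l₁ m₂ m₃ m₁ ∧
      wignerProd n l₁ l₂ l₃ m₁ m₂ m₃ = wignerProd n l₃ l₁ l₂ m₃ m₁ m₂ ∧
      wignerProd n l₁ l₂ l₃ m₁ m₂ m₃ =
        (-1 : ℂ) ^ (l₁ + l₂ + l₃) * wignerProd n l₂ l₁ l₃ m₂ m₁ m₃ ∧
      wignerProd n l₁ l₂ l₃ m₁ m₂ m₃ =
        (-1 : ℂ) ^ (l₁ + l₂ + l₃) * wignerProd n l₁ l₂ l₃ (-m₁) (-m₂) (-m₃) ∧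
      (wignerProd n l₁ l₂ l₃ m₁ m₂ m₃ ≠ 0 → m₁ + m₂ + m₃ = 0 ∧ Triangle l₁ l₂ l₃)) ∧
    (∀ (l₁ l₂ : ℕ) (m₁ m₂ : ℤ), l₁ ≤ n → l₂ ≤ n → |m₁| ≤ (l₁ : ℤ) → |m₂| ≤ (l₂ : ℤ) →
      opBasis n l₁ m₁ * opBasis n l₂ m₂ - opBasis n l₂ m₂ * opBasis n l₁ m₁ =
        ∑ l ∈ (Finset.range (n + 1)).filter
            (fun l => Triangle l₁ l₂ l ∧ l ≡ l₁ + l₂ + 1 [MOD 2]),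
          (2 * (-1 : ℂ) ^ ((n : ℤ) + (m₁ + m₂)) *
            wignerProd n l₁ l₂ l m₁ m₂ (-(m₁ + m₂))) • opBasis n l (m₁ + m₂) ∧
      opBasis n l₁ m₁ * opBasis n l₂ m₂ + opBasis n l₂ m₂ * opBasis n l₁ m₁ =
        ∑ l ∈ (Finset.range (n + 1)).filter
            (fun l => Triangle l₁ l₂ l ∧ l ≡ l₁ + l₂ [MOD 2]),
          (2 * (-1 : ℂ) ^ ((n : ℤ) + (m₁ + m₂)) *
            wignerProd n l₁ l₂ l m₁ m₂ (-(m₁ + m₂))) • opBasis n l (m₁ + m₂)) ∧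
    (∃ K : ℕ → ℕ → ℕ → ℤ → ℤ → ℂ,
      ∀ (l₁ l₂ : ℕ) (m₁ m₂ : ℤ), l₁ ≤ n → l₂ ≤ n → |m₁| ≤ (l₁ : ℤ) → |m₂| ≤ (l₂ : ℤ) →
        opUnnorm n l₁ m₁ * opUnnorm n l₂ m₂ - opUnnorm n l₂ m₂ * opUnnorm n l₁ m₁ =
          ∑ l ∈ (Finset.range (n + 1)).filter
              (fun l => Triangle l₁ l₂ l ∧ l ≡ l₁ + l₂ + 1 [MOD 2]),
            K l₁ l₂ l m₁ m₂ • opUnnorm n l (m₁ + m₂) ∧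
        opUnnorm n l₁ m₁ * opUnnorm n l₂ m₂ + opUnnorm n l₂ m₂ * opUnnorm n l₁ m₁ =
          ∑ l ∈ (Finset.range (n + 1)).filter
              (fun l => Triangle l₁ l₂ l ∧ l ≡ l₁ + l₂ [MOD 2]),
            K l₁ l₂ l m₁ m₂ • opUnnorm n l (m₁ + m₂)) := by
  refine ⟨fun l₁ l₂ m₁ m₂ _ _ _ _ => opBasis_mul_opBasis n l₁ l₂ m₁ m₂,
    fun l₁ l₂ l m₁ m₂ m h₁ h₂ h hm₁ hm₂ hm => prodCoeff_eq_sum_clebschGordan h₁ h₂ h hm₁ hm₂ hm,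
    fun l₁ l₂ l₃ m₁ m₂ m₃ h₁ h₂ h₃ hm₁ hm₂ hm₃ =>
      wignerProd_eq_sum_threeJM h₁ h₂ h₃ hm₁ hm₂ hm₃,
    fun l₁ l₂ l₃ k h₁ h₂ h₃ => recoupling_mag_eq h₁ h₂ h₃ k,
    fun l₁ l₂ l₃ m₁ m₂ m₃ h₁ h₂ h₃ hm₁ hm₂ hm₃ =>
      wignerProd_eq_threeJM_mul_sixJ h₁ h₂ h₃ hm₁ hm₂ hm₃,
    fun l₁ l₂ m₁ m₂ h₁ h₂ hm₁ hm₂ => ?_,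
    fun l₁ l₂ l₃ m₁ m₂ m₃ h₁ h₂ h₃ _ _ _ => ⟨?_, ?_, wignerProd_swap l₁ l₂ h₃ m₁ m₂ m₃,
      wignerProd_neg h₁ h₂ h₃ m₁ m₂ m₃, wignerProd_ne_zero h₁ h₂ h₃⟩,
    fun l₁ l₂ m₁ m₂ h₁ h₂ _ _ => commutator_opBasis n l₁ l₂ m₁ m₂ h₁ h₂,
    exists_commutator_opUnnorm n⟩
  · rw [opBasis_mul_opBasis_wignerProd]
    refine Finset.sum_congr rfl fun l hl => ?_
    have hl : l ≤ n := by simpa [Nat.lt_succ_iff] using hl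
    -- The factorization requires `|m| ≤ l`; for smaller `l` the operator `e^j(l,m)` is zero by
    -- convention and both terms vanish.
    by_cases hm : |m₁ + m₂| ≤ (l : ℤ)
    · rw [wignerProd_eq_threeJM_mul_sixJ h₁ h₂ hl hm₁ hm₂ (by rwa [abs_neg]),
        show -(2 * -(m₁ + m₂)) = 2 * (m₁ + m₂) by ring]
      congr 1
      ring
    · rw [opBasis_of_lt n hm, smul_zero, smul_zero]
  · rw [wignerProd_eq_trace _ _ h₃, wignerProd_eq_trace _ _ h₁, trace_opBasis_cycle]
  · rw [wignerProd_eq_trace _ _ h₃, wignerProd_eq_trace _ _ h₂, ← trace_opBasis_cycle]
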